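/- Let $k$ be a field. A (multiplicative) Hom-Lie algebra $(\mathfrak g,[\,,\,],\phi)$ is a $k$-vector space with an anti-symmetric bilinear bracket and a linear map $\phi$ such that $\phi[\xi,\xi']=[\phi\xi,\phi\xi']$ and $[\phi\xi,[\xi',\xi'']]+[\phi\xi'',[\xi,\xi']]+[\phi\xi',[\xi'',\xi]]=0$. Let $(\mathfrak g,\phi)$, $(\mathfrak h,\alpha)$ be Hom-Lie algebras with $\phi$ and $\alpha$ bijective, forming a matched pair: there are bilinear maps $\triangleright:\mathfrak h\times\mathfrak g\to\mathfrak g$, $\triangleleft:\mathfrak h\times\mathfrak g\to\mathfrak h$ such that, for $\xi,\xi'\in\mathfrak g$, $\eta,\eta'\in\mathfrak h$, $$\phi(\eta\triangleright\xi)=\alpha(\eta)\triangleright\phi(\xi),\qquad [\eta,\eta']\triangleright\phi(\xi)=\alpha(\eta)\triangleright(\eta'\triangleright\xi)-\alpha(\eta')\triangleright(\eta\triangleright\xi),$$ $$\alpha(\eta\triangleleft\xi)=\alpha(\eta)\triangleleft\phi(\xi),\qquad \alpha(\eta)\triangleleft[\xi,\xi']=(\eta\triangleleft\xi)\triangleleft\phi(\xi')-(\eta\triangleleft\xi')\triangleleft\phi(\xi),$$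 $$\alpha(\eta)\triangleright[\xi,\xi']=[\eta\triangleright\xi,\phi(\xi')]+[\phi(\xi),\eta\triangleright\xi']+(\eta\triangleleft\xi)\triangleright\phi(\xi')-(\eta\triangleleft\xi')\triangleright\phi(\xi),$$ $$[\eta,\eta']\triangleleft\phi(\xi)=[\alpha(\eta),\eta'\triangleleft\xi]+[\eta\triangleleft\xi,\alpha(\eta')]+\alpha(\eta)\triangleleft(\eta'\triangleright\xi)-\alpha(\eta')\triangleleft(\eta\triangleright\xi).$$ Universal enveloping Hom-Hopf algebra. Let $\mathbb T^{\mathfrak g}$ be spanned by a symbol $\mathbf 1$ and by the planar binary trees whose leaves carry a weight $s\in\mathbb N$ and an element of $\mathfrak g$, multilinearly in these elements. Let $\mathfrak a$ raise all weights by one, $\mathfrak a(\mathbf 1)=\mathbf 1$, and let $\vee$ be grafting of trees, with $\mathbf 1\vee\mathbf 1=\mathbf 1$ and $t\vee\mathbf 1=\mathbf 1\vee t=\mathfrak a(t)$. Write $(s,\xi)$ for the one-leaf tree. Then $\mathcal U(\mathfrak g)$ is the quotient of $\mathbb T^{\mathfrak g}$ by the two-sided ideal (for $\vee$) generated by all $(x\vee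 y)\vee\mathfrak a(z)-\mathfrak a(x)\vee(y\vee z)$, all $(s,\xi)-(0,\phi^s\xi)$ and all $(0,\xi)\vee(0,\xi')-(0,\xi')\vee(0,\xi)-(0,[\xi,\xi'])$. It has the product $\vee$, the unit $\mathbf 1$, the map induced by $\mathfrak a$ (again denoted $\phi$, since it sends $(s,\xi)$ to $(s,\phi\xi)$), the coproduct $\Delta(\mathbf 1)=\mathbf 1\otimes\mathbf 1$, $\Delta(t)=\sum_{I\sqcup J=\text{leaves of }t}t_I\otimes t_J$ ($t_I$ is $t$ with the leaves outside $I$ replaced by $\mathbf 1$), the counit $\varepsilon(\mathbf 1)=1$, $\varepsilon(t)=0$, and the antipode $S(\mathbf 1)=\mathbf 1$, $S(s,\xi)=-(s,\xi)$, $S(t\vee t')=S(t')\vee S(t)$. Define $\mathcal U(\mathfrak h)$ in the same way, with its twisting map again denoted $\alpha$. Statement. $(\mathcal U(\mathfrak g),\vee,\mathbf 1,\phi,\Delta,\varepsilon,\mathrm{Id},S)$ and $(\mathcal U(\mathfrak h),\vee,\mathbf 1,\alpha,\Delta,\varepsilon,\mathrm{Id},S)$ are Hom-Hopf algebras. Moreover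 there is exactly one pair of bilinear maps $\triangleleft:\mathfrak h\times\mathcal U(\mathfrak g)\to\mathfrak h$, $\triangleright:\mathcal U(\mathfrak h)\times\mathcal U(\mathfrak g)\to\mathcal U(\mathfrak g)$ such that * $(\mathfrak h,\alpha)$ is a right Hom-module over $\mathcal U(\mathfrak g)$, i.e. $(\eta\triangleleft u)\triangleleft\phi(u')=\alpha(\eta)\triangleleft(u\vee u')$ and $\eta\triangleleft\mathbf 1=\alpha(\eta)$, with $\eta\triangleleft(s,\xi)=\eta\triangleleft\phi^s(\xi)$; * $(\mathcal U(\mathfrak g),\phi)$ is a left Hom-module over $\mathcal U(\mathfrak h)$, i.e. $\alpha(\Omega)\triangleright(\Omega'\triangleright u)=(\Omega\vee\Omega')\triangleright\phi(u)$ and $\mathbf 1\triangleright u=\phi(u)$; * for $\eta\in\mathfrak h$, identified with $(0,\eta)\in\mathcal U(\mathfrak h)$: $\eta\triangleright\mathbf 1=0$, $\eta\triangleright(s,\xi)=(s,\alpha^{-s}(\eta)\triangleright\xi)$ (for $s=0$: the action of $\mathfrak h$ on $\mathfrak g$ is extended), and, with $\Delta(u)=u_{(1)}\otimes u_{(2)}$,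 $$\eta\triangleright(u\vee u')=(\alpha^{-1}(\eta)\triangleright u)\vee\phi(u')+\phi(u_{(1)})\vee\big[(\alpha^{-2}(\eta)\triangleleft\phi^{-1}(u_{(2)}))\triangleright u'\big].$$ With this action $\triangleright$, $(\mathcal U(\mathfrak g),\phi)$ is a left $\mathcal U(\mathfrak h)$-Hom-module coalgebra: $\mathcal U(\mathfrak h)$ is a Hom-bialgebra, $(\mathcal U(\mathfrak g),\Delta,\varepsilon,\mathrm{Id})$ is a Hom-coalgebra with Hom-coalgebra endomorphism $\phi$, $(\mathcal U(\mathfrak g),\phi)$ is a left Hom-module over $\mathcal U(\mathfrak h)$, and, for all $\Omega\in\mathcal U(\mathfrak h)$, $u\in\mathcal U(\mathfrak g)$, $$\mathrm{Id}(\Omega\triangleright u)=\mathrm{Id}(\Omega)\triangleright\mathrm{Id}(u),\qquad \Delta(\Omega\triangleright u)=\Omega_{(1)}\triangleright u_{(1)}\otimes\Omega_{(2)}\triangleright u_{(2)},\qquad \varepsilon(\Omega\triangleright u)=\varepsilon(\Omega)\varepsilon(u).$$ -/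

import Mathlib

open scoped TensorProduct

noncomputable section

/-! ### Hom-algebras, Hom-coalgebras, Hom-Hopf algebras and their modules

A product `A ⊗ A → A` or an action is given as a bilinear map `A →ₗ A →ₗ A`, and a unit map
`η : K → A` by the element `η(1)`. -/

section Structures

variable {K : Type*} [Field K]

/-- A unital Hom-associative algebra `(A, μ, η, α)`. -/
structure IsHomAlgebra {A : Type*} [AddCommGroup A] [Module K A]
    (μ : A →ₗ[K] A →ₗ[K] A) (e : A) (α : A →ₗ[K] A) : Prop where
  hom_assoc : ∀ x y z, μ (α x) (μ y z) = μ (μ x y) (α z)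
  one_mul : ∀ x, μ e x = α x
  mul_one : ∀ x, μ x e = α x
  twist_one : α e = e

/-- A counital Hom-coassociative coalgebra `(C, Δ, ε, β)`. -/
structure IsHomCoalgebra {C : Type*} [AddCommGroup C] [Module K C]
    (Δ : C →ₗ[K] C ⊗[K] C) (ε : C →ₗ[K] K) (β : C →ₗ[K] C) : Prop where
  hom_coassoc : ∀ c, TensorProduct.map β Δ (Δ c) =
    TensorProduct.assoc K C C C (TensorProduct.map Δ β (Δ c))
  counit_left : ∀ c, TensorProduct.map ε LinearMap.id (Δ c) = (1 : K) ⊗ₜ[K] β c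
  counit_right : ∀ c, TensorProduct.map LinearMap.id ε (Δ c) = β c ⊗ₜ[K] (1 : K)
  counit_twist : ∀ c, ε (β c) = ε c

/-- `γ` is an endomorphism of the Hom-coalgebra `(C, Δ, ε, β)`. -/
structure IsHomCoalgebraEnd {C : Type*} [AddCommGroup C] [Module K C]
    (Δ : C →ₗ[K] C ⊗[K] C) (ε : C →ₗ[K] K) (β γ : C →ₗ[K] C) : Prop where
  comul : ∀ c, Δ (γ c) = TensorProduct.map γ γ (Δ c)
  counit : ∀ c, ε (γ c) = ε c
  comm : ∀ c, γ (β c) = β (γ c)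

/-- The structure maps `(μ, η, α, Δ, ε, β, S)` of a Hom-Hopf algebra on `A`, without the laws. -/
structure HomHopfData (K : Type*) [Field K] (A : Type*) [AddCommGroup A] [Module K A] where
  mul : A →ₗ[K] A →ₗ[K] A
  one : A
  twist : A →ₗ[K] A
  comul : A →ₗ[K] A ⊗[K] A
  counit : A →ₗ[K] K
  cotwist : A →ₗ[K] A
  antipode : A →ₗ[K] A

namespace HomHopfData

variable {A : Type*} [AddCommGroup A] [Module K A]

/-- The laws of a unital and counital Hom-bialgebra. -/
structure IsHomBialgebra (B : HomHopfData K A) : Prop where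
  algebra : IsHomAlgebra B.mul B.one B.twist
  coalgebra : IsHomCoalgebra B.comul B.counit B.cotwist
  comul_one : B.comul B.one = B.one ⊗ₜ[K] B.one
  comul_mul : ∀ x y, B.comul (B.mul x y) =
    TensorProduct.map₂ B.mul B.mul (B.comul x) (B.comul y)
  comul_twist : ∀ x, B.comul (B.twist x) = TensorProduct.map B.twist B.twist (B.comul x)
  counit_one : B.counit B.one = 1
  counit_mul : ∀ x y, B.counit (B.mul x y) = B.counit x * B.counit y
  counit_twist : ∀ x, B.counit (B.twist x) = B.counit x
  cotwist_one : B.cotwist B.one = B.one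
  cotwist_mul : ∀ x y, B.cotwist (B.mul x y) = B.mul (B.cotwist x) (B.cotwist y)
  cotwist_twist : ∀ x, B.cotwist (B.twist x) = B.twist (B.cotwist x)

/-- The laws of an `(α, β)`-Hom-Hopf algebra. -/
structure IsHomHopf (B : HomHopfData K A) : Prop where
  bialgebra : B.IsHomBialgebra
  antipode_left : ∀ x,
    TensorProduct.lift B.mul (TensorProduct.map B.antipode LinearMap.id (B.comul x)) =
      B.counit x • B.one
  antipode_right : ∀ x,
    TensorProduct.lift B.mul (TensorProduct.map LinearMap.id B.antipode (B.comul x)) =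
      B.counit x • B.one
  antipode_twist : ∀ x, B.antipode (B.twist x) = B.twist (B.antipode x)
  antipode_cotwist : ∀ x, B.antipode (B.cotwist x) = B.cotwist (B.antipode x)

end HomHopfData

variable {A : Type*} [AddCommGroup A] [Module K A] {M : Type*} [AddCommGroup M] [Module K M]

/-- `(M, γ)` is a left Hom-module over the unital Hom-algebra `(A, μ, e, α)` via
`ρ a m = a ▷ m`. -/
structure IsLeftHomModule (μ : A →ₗ[K] A →ₗ[K] A) (e : A) (α : A →ₗ[K] A)
    (γ : M →ₗ[K] M) (ρ : A →ₗ[K] M →ₗ[K] M) : Prop where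
  assoc : ∀ a b m, ρ (α a) (ρ b m) = ρ (μ a b) (γ m)
  one : ∀ m, ρ e m = γ m

/-- `(M, γ)` is a right Hom-module over the unital Hom-algebra `(A, μ, e, α)` via
`ρ m a = m ◁ a`. -/
structure IsRightHomModule (μ : A →ₗ[K] A →ₗ[K] A) (e : A) (α : A →ₗ[K] A)
    (γ : M →ₗ[K] M) (ρ : M →ₗ[K] A →ₗ[K] M) : Prop where
  assoc : ∀ m a b, ρ (ρ m a) (α b) = ρ (γ m) (μ a b)
  one : ∀ m, ρ m e = γ m

/-- The Hom-coalgebra `(C, Δ, ε, β)` with its endomorphism `γ` is a left Hom-module coalgebra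
over the Hom-bialgebra `B` via `ρ b c = b ▷ c`. -/
structure IsLeftHomModuleCoalgebra (B : HomHopfData K A) {C : Type*} [AddCommGroup C] [Module K C]
    (Δ : C →ₗ[K] C ⊗[K] C) (ε : C →ₗ[K] K) (β γ : C →ₗ[K] C)
    (ρ : A →ₗ[K] C →ₗ[K] C) : Prop where
  bialgebra : B.IsHomBialgebra
  coalgebra : IsHomCoalgebra Δ ε β
  endo : IsHomCoalgebraEnd Δ ε β γ
  module : IsLeftHomModule B.mul B.one B.twist γ ρ
  cotwist : ∀ b c, β (ρ b c) = ρ (B.cotwist b) (β c)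
  comul : ∀ b c, Δ (ρ b c) = TensorProduct.map₂ ρ ρ (B.comul b) (Δ c)
  counit : ∀ b c, ε (ρ b c) = B.counit b * ε c

end Structures

/-! ### Hom-Lie algebras and matched pairs -/

/-- A multiplicative Hom-Lie algebra structure `([ , ], φ)` on the vector space `g`. -/
structure HomLie (K : Type*) [Field K] (g : Type*) [AddCommGroup g] [Module K g] where
  bracket : g →ₗ[K] g →ₗ[K] g
  twist : g →ₗ[K] g
  antisymm : ∀ x y, bracket x y = -bracket y x
  jacobi : ∀ x y z, bracket (twist x) (bracket y z) + bracket (twist z) (bracket x y)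
    + bracket (twist y) (bracket z x) = 0
  twist_bracket : ∀ x y, twist (bracket x y) = bracket (twist x) (twist y)

/-- A matched pair `(g, φ)`, `(h, α)` of Hom-Lie algebras: `left η ξ = η ▷ ξ` makes `(g, φ)` a
left `h`-module, `right η ξ = η ◁ ξ` makes `(h, α)` a right `g`-module, and the two actions are
compatible. -/
structure HomLieMatchedPair {K : Type*} [Field K] {g h : Type*} [AddCommGroup g] [Module K g]
    [AddCommGroup h] [Module K h] (G : HomLie K g) (H : HomLie K h) where
  left : h →ₗ[K] g →ₗ[K] g
  right : h →ₗ[K] g →ₗ[K] h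
  twist_left : ∀ η ξ, G.twist (left η ξ) = left (H.twist η) (G.twist ξ)
  bracket_left : ∀ η η' ξ, left (H.bracket η η') (G.twist ξ) =
    left (H.twist η) (left η' ξ) - left (H.twist η') (left η ξ)
  twist_right : ∀ η ξ, H.twist (right η ξ) = right (H.twist η) (G.twist ξ)
  right_bracket : ∀ η ξ ξ', right (H.twist η) (G.bracket ξ ξ') =
    right (right η ξ) (G.twist ξ') - right (right η ξ') (G.twist ξ)
  left_compat : ∀ η ξ ξ', left (H.twist η) (G.bracket ξ ξ') =
    G.bracket (left η ξ) (G.twist ξ') + G.bracket (G.twist ξ) (left η ξ')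
      + left (right η ξ) (G.twist ξ') - left (right η ξ') (G.twist ξ)
  right_compat : ∀ η η' ξ, right (H.bracket η η') (G.twist ξ) =
    H.bracket (H.twist η) (right η' ξ) + H.bracket (right η ξ) (H.twist η')
      + right (H.twist η) (left η' ξ) - right (H.twist η') (left η ξ)

/-! ### Weighted trees -/

/-- Planar binary trees with at least one leaf, each leaf carrying a weight in `ℕ` and a
decoration in `g`. -/
inductive WTree (g : Type*) where
  | leaf (s : ℕ) (ξ : g) : WTree g
  | graft (l r : WTree g) : WTree g

namespace WTree

variable {g : Type*}

/-- Raise all weights by one. -/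
def raise : WTree g → WTree g
  | leaf s ξ => leaf (s + 1) ξ
  | graft l r => graft l.raise r.raise

/-- `raise` on trees together with the external object `𝟏 = none`. -/
def raise₁ : Option (WTree g) → Option (WTree g) := Option.map raise

/-- Grafting of trees, extended to the external object `𝟏 = none` by `𝟏 ∨ 𝟏 = 𝟏` and
`t ∨ 𝟏 = 𝟏 ∨ t = raise t`. -/
def graft₁ : Option (WTree g) → Option (WTree g) → Option (WTree g)
  | none, none => none
  | some l, none => some l.raise
  | none, some r => some r.raise
  | some l, some r => some (graft l r)

end WTree

/-- The vector space with basis `𝟏` and all weighted decorated trees. (Linearity in each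
decoration is imposed in the quotient below.) -/
abbrev TreeSpace (K : Type*) [Field K] (g : Type*) : Type _ := Option (WTree g) →₀ K

namespace TreeSpace

variable {K : Type*} [Field K] {g : Type*}

/-- The basis vector of a tree, or of `𝟏 = none`. -/
def of (t : Option (WTree g)) : TreeSpace K g := Finsupp.single t 1

variable (K) in
/-- The one-leaf tree of weight `s` with decoration `ξ`. -/
def leaf (s : ℕ) (ξ : g) : TreeSpace K g := of (some (WTree.leaf s ξ))

variable (K g) in
/-- The grafting product. -/
def mul : TreeSpace K g →ₗ[K] TreeSpace K g →ₗ[K] TreeSpace K g :=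
  Finsupp.linearCombination K fun s =>
    Finsupp.linearCombination K fun t => of (WTree.graft₁ s t)

variable (K g) in
/-- The twisting map: all weights go up by one, and `𝟏 ↦ 𝟏`. -/
def twist : TreeSpace K g →ₗ[K] TreeSpace K g :=
  Finsupp.linearCombination K fun t => of (WTree.raise₁ t)

/-- The coproduct of a tree `t`: the sum of `t_I ⊗ t_J` over all ways to distribute the leaves of
`t` into disjoint `I` and `J`, where `t_I` is `t` with the leaves outside `I` replaced by `𝟏`.
Since `(l ∨ r)_{I ⊔ I'} = l_I ∨ r_{I'}`, the sum for `l ∨ r` is the product of the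
sums for `l` and `r`. -/
def comulTree : WTree g → TreeSpace K g ⊗[K] TreeSpace K g
  | WTree.leaf s ξ => leaf K s ξ ⊗ₜ of none + of none ⊗ₜ leaf K s ξ
  | WTree.graft l r => TensorProduct.map₂ (mul K g) (mul K g) (comulTree l) (comulTree r)

/-- The coproduct on `𝟏` and trees. -/
def comulBasis : Option (WTree g) → TreeSpace K g ⊗[K] TreeSpace K g
  | none => of none ⊗ₜ of none
  | some t => comulTree t

variable (K g) in
/-- The coproduct. -/
def comul : TreeSpace K g →ₗ[K] TreeSpace K g ⊗[K] TreeSpace K g :=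
  Finsupp.linearCombination K comulBasis

variable (K g) in
/-- The counit: the coefficient of `𝟏`. -/
def counit : TreeSpace K g →ₗ[K] K := Finsupp.lapply none

/-- The antipode of a tree. -/
def antipodeTree : WTree g → TreeSpace K g
  | WTree.leaf s ξ => -leaf K s ξ
  | WTree.graft l r => mul K g (antipodeTree r) (antipodeTree l)

/-- The antipode on `𝟏` and trees. -/
def antipodeBasis : Option (WTree g) → TreeSpace K g
  | none => of none
  | some t => antipodeTree t

variable (K g) in
/-- The antipode. -/
def antipode : TreeSpace K g →ₗ[K] TreeSpace K g := Finsupp.linearCombination K antipodeBasis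

@[simp] lemma mul_of (s t : Option (WTree g)) :
    mul K g (of s) (of t) = of (WTree.graft₁ s t) := by simp [mul, of]

@[simp] lemma twist_of (t : Option (WTree g)) : twist K g (of t) = of (WTree.raise₁ t) := by
  simp [twist, of]

@[simp] lemma comul_of (t : Option (WTree g)) : comul K g (of t) = comulBasis t := by
  simp [comul, of]

@[simp] lemma counit_none : counit K g (of none) = 1 := by simp [counit, of]

@[simp] lemma counit_some (t : WTree g) : counit K g (of (some t)) = 0 := by simp [counit, of]

@[simp] lemma antipode_of (t : Option (WTree g)) : antipode K g (of t) = antipodeBasis t := by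
  simp [antipode, of]

lemma induction {p : TreeSpace K g → Prop} (x : TreeSpace K g) (hof : ∀ t, p (of t))
    (hzero : p 0) (hadd : ∀ x y, p x → p y → p (x + y))
    (hsmul : ∀ (c : K) x, p x → p (c • x)) : p x := by
  induction x using Finsupp.induction_linear with
  | zero => exact hzero
  | add f g hf hg => exact hadd f g hf hg
  | single a b => simpa [of] using hsmul b _ (hof a)

lemma one_mul (x : TreeSpace K g) : mul K g (of none) x = twist K g x := by
  induction x using induction with
  | hof t => cases t <;> simp [WTree.graft₁, WTree.raise₁]
  | hzero => simp
  | hadd x y hx hy => simp [hx, hy]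
  | hsmul c x hx => simp [hx]

lemma mul_one (x : TreeSpace K g) : mul K g x (of none) = twist K g x := by
  induction x using induction with
  | hof t => cases t <;> simp [WTree.graft₁, WTree.raise₁]
  | hzero => simp
  | hadd x y hx hy => simp [hx, hy]
  | hsmul c x hx => simp [hx]

lemma twist_mul (x y : TreeSpace K g) :
    twist K g (mul K g x y) = mul K g (twist K g x) (twist K g y) := by
  induction x using induction with
  | hof s =>
    induction y using induction with
    | hof t => cases s <;> cases t <;> simp [WTree.graft₁, WTree.raise₁, WTree.raise]
    | hzero => simp
    | hadd x y hx hy => simp [hx, hy]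
    | hsmul c x hx => simp [hx]
  | hzero => simp
  | hadd x y hx hy => simp [hx, hy]
  | hsmul c x hx => simp [hx]

lemma counit_mul (x y : TreeSpace K g) :
    counit K g (mul K g x y) = counit K g x * counit K g y := by
  induction x using induction with
  | hof s =>
    induction y using induction with
    | hof t => cases s <;> cases t <;> simp [WTree.graft₁]
    | hzero => simp
    | hadd x y hx hy => simp [hx, hy, mul_add]
    | hsmul c x hx => simp [hx, mul_left_comm]
  | hzero => simp
  | hadd x y hx hy => simp [hx, hy, add_mul]
  | hsmul c x hx => simp [hx, mul_assoc]

lemma twist_map₂ (z w : TreeSpace K g ⊗[K] TreeSpace K g) :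
    TensorProduct.map (twist K g) (twist K g)
        (TensorProduct.map₂ (mul K g) (mul K g) z w) =
      TensorProduct.map₂ (mul K g) (mul K g)
        (TensorProduct.map (twist K g) (twist K g) z)
        (TensorProduct.map (twist K g) (twist K g) w) := by
  induction z with
  | zero => simp
  | add a b ha hb => simp [ha, hb]
  | tmul a b =>
    induction w with
    | zero => simp
    | add a b ha hb => simp only [map_add, ha, hb]
    | tmul c d => simp [twist_mul]

lemma comulTree_raise (t : WTree g) : comulTree (K := K) t.raise =
    TensorProduct.map (twist K g) (twist K g) (comulTree t) := by
  induction t with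
  | leaf s ξ => simp [comulTree, WTree.raise, leaf, WTree.raise₁]
  | graft l r hl hr => simp [comulTree, WTree.raise, hl, hr, twist_map₂]

lemma one_map₂ (z : TreeSpace K g ⊗[K] TreeSpace K g) :
    TensorProduct.map₂ (mul K g) (mul K g) (of none ⊗ₜ of none) z =
      TensorProduct.map (twist K g) (twist K g) z := by
  induction z with
  | zero => simp
  | add a b ha hb => simp only [map_add, ha, hb]
  | tmul a b => simp [one_mul]

lemma map₂_one (z : TreeSpace K g ⊗[K] TreeSpace K g) :
    TensorProduct.map₂ (mul K g) (mul K g) z (of none ⊗ₜ of none) =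
      TensorProduct.map (twist K g) (twist K g) z := by
  induction z with
  | zero => simp
  | add a b ha hb => simp [ha, hb]
  | tmul a b => simp [mul_one]

lemma comul_mul (x y : TreeSpace K g) : comul K g (mul K g x y) =
    TensorProduct.map₂ (mul K g) (mul K g) (comul K g x) (comul K g y) := by
  induction x using induction with
  | hof s =>
    induction y using induction with
    | hof t =>
      rw [mul_of, comul_of, comul_of, comul_of]
      cases s <;> cases t <;>
        simp only [WTree.graft₁, comulBasis, comulTree_raise, one_map₂, map₂_one, comulTree]
      simp [WTree.raise₁]
    | hzero => simp
    | hadd x y hx hy => simp [hx, hy]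
    | hsmul c x hx => simp [hx]
  | hzero => simp
  | hadd x y hx hy => simp [hx, hy]
  | hsmul c x hx => simp [hx]

lemma comul_twist (x : TreeSpace K g) : comul K g (twist K g x) =
    TensorProduct.map (twist K g) (twist K g) (comul K g x) := by
  rw [← one_mul, comul_mul, comul_of]
  exact one_map₂ _

lemma antipodeTree_raise (t : WTree g) :
    antipodeTree (K := K) t.raise = twist K g (antipodeTree t) := by
  induction t with
  | leaf s ξ => simp [antipodeTree, WTree.raise, leaf, WTree.raise₁]
  | graft l r hl hr => simp [antipodeTree, WTree.raise, hl, hr, twist_mul]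

lemma antipode_mul (x y : TreeSpace K g) : antipode K g (mul K g x y) =
    mul K g (antipode K g y) (antipode K g x) := by
  induction x using induction with
  | hof s =>
    induction y using induction with
    | hof t =>
      cases s <;> cases t <;>
        simp [WTree.graft₁, antipodeBasis, antipodeTree_raise, antipodeTree, one_mul, mul_one,
          WTree.raise₁]
    | hzero => simp
    | hadd x y hx hy => simp [hx, hy]
    | hsmul c x hx => simp [hx]
  | hzero => simp
  | hadd x y hx hy => simp [hx, hy]
  | hsmul c x hx => simp [hx]

lemma antipode_twist (x : TreeSpace K g) :
    antipode K g (twist K g x) = twist K g (antipode K g x) := by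
  rw [← one_mul, antipode_mul, antipode_of]
  exact mul_one _

end TreeSpace

/-! ### The universal enveloping Hom-Hopf algebra -/

namespace HomLie

variable {K : Type*} [Field K] {g : Type*} [AddCommGroup g] [Module K g]

/-- Generators of the ideal defining the universal enveloping algebra: linearity of trees in each
decoration, Hom-associativity, and the relations `(s, ξ) = (0, φ^s ξ)` and
`ξ ∨ ξ' - ξ' ∨ ξ = [ξ, ξ']`; closed under products with arbitrary elements. -/
inductive Rel (G : HomLie K g) : TreeSpace K g → Prop
  | add (s : ℕ) (ξ ξ' : g) : Rel G
      (TreeSpace.leaf K s (ξ + ξ') - (TreeSpace.leaf K s ξ + TreeSpace.leaf K s ξ'))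
  | smul (s : ℕ) (c : K) (ξ : g) : Rel G
      (TreeSpace.leaf K s (c • ξ) - c • TreeSpace.leaf K s ξ)
  | hom_assoc (x y z : TreeSpace K g) : Rel G
      (TreeSpace.mul K g (TreeSpace.mul K g x y) (TreeSpace.twist K g z)
        - TreeSpace.mul K g (TreeSpace.twist K g x) (TreeSpace.mul K g y z))
  | weight (s : ℕ) (ξ : g) : Rel G
      (TreeSpace.leaf K s ξ - TreeSpace.leaf K 0 ((G.twist ^ s) ξ))
  | bracket (ξ ξ' : g) : Rel G
      (TreeSpace.mul K g (TreeSpace.leaf K 0 ξ) (TreeSpace.leaf K 0 ξ')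
        - TreeSpace.mul K g (TreeSpace.leaf K 0 ξ') (TreeSpace.leaf K 0 ξ)
        - TreeSpace.leaf K 0 (G.bracket ξ ξ'))
  | mul_left (x y : TreeSpace K g) : Rel G y → Rel G (TreeSpace.mul K g x y)
  | mul_right (x y : TreeSpace K g) : Rel G x → Rel G (TreeSpace.mul K g x y)

/-- The two-sided ideal spanned by the relations. -/
def ideal (G : HomLie K g) : Submodule K (TreeSpace K g) := Submodule.span K {x | G.Rel x}

/-- The underlying vector space of the universal enveloping Hom-Hopf algebra. -/
abbrev U (G : HomLie K g) : Type _ := TreeSpace K g ⧸ G.ideal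

/-- The projection from trees to the enveloping algebra. -/
abbrev proj (G : HomLie K g) : TreeSpace K g →ₗ[K] G.U := G.ideal.mkQ

lemma mul_mem_left (G : HomLie K g) (x : TreeSpace K g) {y : TreeSpace K g}
    (hy : y ∈ G.ideal) : TreeSpace.mul K g x y ∈ G.ideal := by
  have : G.ideal ≤ G.ideal.comap (TreeSpace.mul K g x) :=
    Submodule.span_le.2 fun y hy => Submodule.subset_span (Rel.mul_left x y hy)
  exact this hy

lemma mul_mem_right (G : HomLie K g) {x : TreeSpace K g} (y : TreeSpace K g)
    (hx : x ∈ G.ideal) : TreeSpace.mul K g x y ∈ G.ideal := by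
  have : G.ideal ≤ G.ideal.comap ((TreeSpace.mul K g).flip y) :=
    Submodule.span_le.2 fun x hx => Submodule.subset_span (Rel.mul_right x y hx)
  exact this hx

/-- The product of the enveloping algebra. -/
def uMul (G : HomLie K g) : G.U →ₗ[K] G.U →ₗ[K] G.U :=
  G.ideal.liftQ
    ((G.ideal.liftQ ((TreeSpace.mul K g).compr₂ G.proj).flip (fun y hy => by
      refine LinearMap.ext fun x => ?_
      simpa using G.mul_mem_left x hy)).flip)
    (fun x hx => by
      refine LinearMap.ext fun z => ?_
      obtain ⟨y, rfl⟩ := G.ideal.mkQ_surjective z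
      exact (Submodule.Quotient.mk_eq_zero _).2 (G.mul_mem_right y hx))

@[simp] lemma uMul_proj (G : HomLie K g) (x y : TreeSpace K g) :
    G.uMul (G.proj x) (G.proj y) = G.proj (TreeSpace.mul K g x y) := rfl

/-- The unit `𝟏`. -/
def uOne (G : HomLie K g) : G.U := G.proj (TreeSpace.of none)

lemma twist_mem (G : HomLie K g) : G.ideal ≤ G.ideal.comap (TreeSpace.twist K g) := by
  intro x hx
  rw [Submodule.mem_comap, ← TreeSpace.one_mul]
  exact G.mul_mem_left _ hx

/-- The twisting map of the enveloping algebra. -/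
def uTwist (G : HomLie K g) : G.U →ₗ[K] G.U :=
  G.ideal.mapQ G.ideal (TreeSpace.twist K g) G.twist_mem

@[simp] lemma uTwist_proj (G : HomLie K g) (x : TreeSpace K g) :
    G.uTwist (G.proj x) = G.proj (TreeSpace.twist K g x) := rfl

lemma proj_eq (G : HomLie K g) {x y : TreeSpace K g} (h : G.Rel (x - y)) :
    G.proj x = G.proj y := (Submodule.Quotient.eq _).2 (Submodule.subset_span h)

/-- The image in the enveloping algebra of the one-leaf tree of weight `s`; it is linear in the
decoration. -/
def uLeaf (G : HomLie K g) (s : ℕ) : g →ₗ[K] G.U where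
  toFun ξ := G.proj (TreeSpace.leaf K s ξ)
  map_add' ξ ξ' := by rw [← map_add]; exact G.proj_eq (Rel.add s ξ ξ')
  map_smul' c ξ := by rw [RingHom.id_apply, ← map_smul]; exact G.proj_eq (Rel.smul s c ξ)

/-- On the enveloping algebra, raising the weight is the same as applying `φ` to the
decoration. -/
lemma uTwist_uLeaf (G : HomLie K g) (s : ℕ) (ξ : g) :
    G.uTwist (G.uLeaf s ξ) = G.uLeaf s (G.twist ξ) := by
  have h1 : G.uTwist (G.uLeaf s ξ) = G.uLeaf (s + 1) ξ :=
    congrArg G.proj (TreeSpace.twist_of _)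
  rw [h1]
  have h2 := G.proj_eq (Rel.weight (s + 1) ξ)
  have h3 := G.proj_eq (Rel.weight s (G.twist ξ))
  rw [pow_succ] at h2
  exact h2.trans h3.symm

lemma uMul_assoc (G : HomLie K g) (a b c : G.U) :
    G.uMul (G.uMul a b) (G.uTwist c) = G.uMul (G.uTwist a) (G.uMul b c) := by
  obtain ⟨x, rfl⟩ := G.ideal.mkQ_surjective a
  obtain ⟨y, rfl⟩ := G.ideal.mkQ_surjective b
  obtain ⟨z, rfl⟩ := G.ideal.mkQ_surjective c
  exact G.proj_eq (Rel.hom_assoc x y z)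

lemma map_proj_map₂ (G : HomLie K g) (z w : TreeSpace K g ⊗[K] TreeSpace K g) :
    TensorProduct.map G.proj G.proj
        (TensorProduct.map₂ (TreeSpace.mul K g) (TreeSpace.mul K g) z w) =
      TensorProduct.map₂ G.uMul G.uMul (TensorProduct.map G.proj G.proj z)
        (TensorProduct.map G.proj G.proj w) := by
  induction z with
  | zero => simp
  | add a b ha hb => simp only [map_add, LinearMap.add_apply, ha, hb]
  | tmul a b =>
    induction w with
    | zero => simp
    | add a b ha hb => simp only [map_add, ha, hb]
    | tmul c d => rfl

lemma map_proj_twist (G : HomLie K g) (z : TreeSpace K g ⊗[K] TreeSpace K g) :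
    TensorProduct.map G.proj G.proj
        (TensorProduct.map (TreeSpace.twist K g) (TreeSpace.twist K g) z) =
      TensorProduct.map G.uTwist G.uTwist (TensorProduct.map G.proj G.proj z) := by
  induction z with
  | zero => simp
  | add a b ha hb => simp only [map_add, ha, hb]
  | tmul a b => rfl

lemma map₂_assoc (G : HomLie K g) (x y z : G.U ⊗[K] G.U) :
    TensorProduct.map₂ G.uMul G.uMul (TensorProduct.map₂ G.uMul G.uMul x y)
        (TensorProduct.map G.uTwist G.uTwist z) =
      TensorProduct.map₂ G.uMul G.uMul (TensorProduct.map G.uTwist G.uTwist x)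
        (TensorProduct.map₂ G.uMul G.uMul y z) := by
  induction x with
  | zero => simp
  | add a b ha hb => simp only [map_add, LinearMap.add_apply, ha, hb]
  | tmul a b =>
    induction y with
    | zero => simp
    | add a b ha hb => simp only [map_add, LinearMap.add_apply, ha, hb]
    | tmul c d =>
      induction z with
      | zero => simp
      | add a b ha hb => simp only [map_add, ha, hb]
      | tmul e f => simp only [TensorProduct.map₂_apply_tmul, TensorProduct.map_tmul, uMul_assoc]

lemma map_proj_comul_leaf (G : HomLie K g) (s : ℕ) (ξ : g) :
    TensorProduct.map G.proj G.proj (TreeSpace.comul K g (TreeSpace.leaf K s ξ)) =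
      G.uLeaf s ξ ⊗ₜ G.uOne + G.uOne ⊗ₜ G.uLeaf s ξ := by
  rw [TreeSpace.leaf, TreeSpace.comul_of, TreeSpace.comulBasis, TreeSpace.comulTree, map_add]
  rfl

lemma uLeaf_weight (G : HomLie K g) (s : ℕ) (ξ : g) :
    G.uLeaf s ξ = G.uLeaf 0 ((G.twist ^ s) ξ) := G.proj_eq (Rel.weight s ξ)

lemma uLeaf_bracket (G : HomLie K g) (ξ ξ' : g) :
    G.uMul (G.uLeaf 0 ξ) (G.uLeaf 0 ξ') - G.uMul (G.uLeaf 0 ξ') (G.uLeaf 0 ξ) =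
      G.uLeaf 0 (G.bracket ξ ξ') := G.proj_eq (Rel.bracket ξ ξ')

lemma uOne_mul (G : HomLie K g) (a : G.U) : G.uMul G.uOne a = G.uTwist a := by
  obtain ⟨x, rfl⟩ := G.ideal.mkQ_surjective a
  exact congrArg G.proj (TreeSpace.one_mul x)

lemma mul_uOne (G : HomLie K g) (a : G.U) : G.uMul a G.uOne = G.uTwist a := by
  obtain ⟨x, rfl⟩ := G.ideal.mkQ_surjective a
  exact congrArg G.proj (TreeSpace.mul_one x)

lemma uTwist_uOne (G : HomLie K g) : G.uTwist G.uOne = G.uOne :=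
  congrArg G.proj (TreeSpace.twist_of none)

lemma comul_rel (G : HomLie K g) {x : TreeSpace K g} (hx : G.Rel x) :
    TensorProduct.map G.proj G.proj (TreeSpace.comul K g x) = 0 := by
  induction hx with
  | add s ξ ξ' =>
    simp only [map_sub, map_add, map_proj_comul_leaf, TensorProduct.add_tmul,
      TensorProduct.tmul_add]
    abel
  | smul s c ξ =>
    simp only [map_sub, map_smul, map_proj_comul_leaf, smul_add, TensorProduct.smul_tmul',
      TensorProduct.tmul_smul, sub_self]
  | hom_assoc x y z =>
    simp only [map_sub, TreeSpace.comul_mul, TreeSpace.comul_twist, map_proj_map₂,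
      map_proj_twist, map₂_assoc, sub_self]
  | weight s ξ =>
    rw [map_sub, map_sub, map_proj_comul_leaf, map_proj_comul_leaf, ← uLeaf_weight, sub_self]
  | bracket ξ ξ' =>
    simp only [map_sub, TreeSpace.comul_mul, map_proj_map₂, map_proj_comul_leaf, map_add,
      LinearMap.add_apply, TensorProduct.map₂_apply_tmul, TensorProduct.map_tmul, uOne_mul, mul_uOne, uTwist_uOne,
      ← uLeaf_bracket, TensorProduct.sub_tmul, TensorProduct.tmul_sub]
    abel
  | mul_left x y _ ih => rw [TreeSpace.comul_mul, map_proj_map₂, ih, map_zero]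
  | mul_right x y _ ih =>
    rw [TreeSpace.comul_mul, map_proj_map₂, ih, map_zero, LinearMap.zero_apply]

/-- The coproduct of the enveloping algebra. -/
def uComul (G : HomLie K g) : G.U →ₗ[K] G.U ⊗[K] G.U :=
  G.ideal.liftQ (TensorProduct.map G.proj G.proj ∘ₗ TreeSpace.comul K g)
    (Submodule.span_le.2 fun _ hx => G.comul_rel hx)

lemma counit_rel (G : HomLie K g) {x : TreeSpace K g} (hx : G.Rel x) :
    TreeSpace.counit K g x = 0 := by
  have htw : ∀ y, TreeSpace.counit K g (TreeSpace.twist K g y) = TreeSpace.counit K g y := by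
    intro y
    rw [← TreeSpace.one_mul, TreeSpace.counit_mul, TreeSpace.counit_none, _root_.one_mul]
  induction hx with
  | add s ξ ξ' => simp [TreeSpace.leaf]
  | smul s c ξ => simp [TreeSpace.leaf]
  | hom_assoc x y z => simp only [map_sub, TreeSpace.counit_mul, htw]; ring
  | weight s ξ => simp [TreeSpace.leaf]
  | bracket ξ ξ' => simp [TreeSpace.leaf, WTree.graft₁]
  | mul_left x y _ ih => rw [TreeSpace.counit_mul, ih, mul_zero]
  | mul_right x y _ ih => rw [TreeSpace.counit_mul, ih, zero_mul]

/-- The counit of the enveloping algebra. -/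
def uCounit (G : HomLie K g) : G.U →ₗ[K] K :=
  G.ideal.liftQ (TreeSpace.counit K g) (Submodule.span_le.2 fun _ hx => G.counit_rel hx)

lemma antipode_rel (G : HomLie K g) {x : TreeSpace K g} (hx : G.Rel x) :
    G.proj (TreeSpace.antipode K g x) = 0 := by
  have hl : ∀ s ξ, G.proj (TreeSpace.antipode K g (TreeSpace.leaf K s ξ)) = -G.uLeaf s ξ := by
    intro s ξ
    rw [TreeSpace.leaf, TreeSpace.antipode_of, TreeSpace.antipodeBasis, TreeSpace.antipodeTree,
      map_neg]
    rfl
  induction hx with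
  | add s ξ ξ' => simp only [map_sub, map_add, hl]; abel
  | smul s c ξ => simp only [map_sub, map_smul, hl]; simp
  | hom_assoc x y z =>
    simp only [map_sub, TreeSpace.antipode_mul, TreeSpace.antipode_twist, ← uMul_proj,
      ← uTwist_proj, uMul_assoc, sub_self]
  | weight s ξ => rw [map_sub, map_sub, hl, hl, ← uLeaf_weight, sub_self]
  | bracket ξ ξ' =>
    simp only [map_sub, TreeSpace.antipode_mul, ← uMul_proj, hl, ← uLeaf_bracket, map_neg,
      LinearMap.neg_apply]
    abel
  | mul_left x y _ ih =>
    rw [TreeSpace.antipode_mul, ← uMul_proj, ih, map_zero, LinearMap.zero_apply]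
  | mul_right x y _ ih => rw [TreeSpace.antipode_mul, ← uMul_proj, ih, map_zero]

/-- The antipode of the enveloping algebra. -/
def uAntipode (G : HomLie K g) : G.U →ₗ[K] G.U :=
  G.ideal.liftQ (G.proj ∘ₗ TreeSpace.antipode K g)
    (Submodule.span_le.2 fun _ hx => G.antipode_rel hx)

/-- The universal enveloping Hom-Hopf algebra `(U(g), ∨, 𝟏, φ, Δ, ε, Id, S)`. -/
def env (G : HomLie K g) : HomHopfData K G.U where
  mul := G.uMul
  one := G.uOne
  twist := G.uTwist
  comul := G.uComul
  counit := G.uCounit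
  cotwist := LinearMap.id
  antipode := G.uAntipode

end HomLie

/-! ### The induced actions -/

namespace HomLieMatchedPair

variable {K : Type*} [Field K] {g h : Type*} [AddCommGroup g] [Module K g]
  [AddCommGroup h] [Module K h] {G : HomLie K g} {H : HomLie K h}

/-- For bijective twisting maps `φ`, `α`, the maps `R η u = η ◁ u` and `L Ω u = Ω ▷ u` are the
actions of `U(g)` on `h` and of `U(h)` on `U(g)` induced by the matched pair. Namely, `(h, α)` is
a right Hom-module over `U(g)` with `η ◁ (s, ξ) = η ◁ φ^s ξ`, and `(U(g), φ)` is a left Hom-module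
over `U(h)` with `η ▷ 𝟏 = 0`, `η ▷ (s, ξ) = (s, α^{-s}(η) ▷ ξ)` and
`η ▷ (u ∨ u') = (α⁻¹(η) ▷ u) ∨ φ(u') + φ(u₁) ∨ ((α⁻²(η) ◁ φ⁻¹(u₂)) ▷ u')`
for `η` in `h`. In the last two formulas the inverses are removed by writing `α^s(η)` for `η`,
respectively `α²(η)` for `η` and `φ(w)` for `u`. -/
structure IsInduced (P : HomLieMatchedPair G H) (R : h →ₗ[K] G.U →ₗ[K] h)
    (L : H.U →ₗ[K] G.U →ₗ[K] G.U) : Prop where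
  right_module : IsRightHomModule G.env.mul G.env.one G.env.twist H.twist R
  right_leaf : ∀ η s ξ, R η (G.uLeaf s ξ) = P.right η ((G.twist ^ s) ξ)
  left_module : IsLeftHomModule H.env.mul H.env.one H.env.twist G.env.twist L
  left_one : ∀ η, L (H.uLeaf 0 η) G.env.one = 0
  left_leaf : ∀ η s ξ, L (H.uLeaf 0 ((H.twist ^ s) η)) (G.uLeaf s ξ) = G.uLeaf s (P.left η ξ)
  left_mul : ∀ η w u', L (H.uLeaf 0 (H.twist (H.twist η))) (G.env.mul (G.env.twist w) u') =
    G.env.mul (L (H.uLeaf 0 (H.twist η)) (G.env.twist w)) (G.env.twist u') +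
      TensorProduct.lift
        (G.env.mul.compl₁₂ (G.env.twist ∘ₗ G.env.twist) (L.flip u' ∘ₗ H.uLeaf 0 ∘ₗ R η))
        (G.env.comul w)

end HomLieMatchedPair

end

noncomputable section

/-! ### Functoriality of the enveloping algebra -/

/-! Bijectivity of `φ` allows everything to be untwisted. Applying `φ⁻¹` to all decorations respects
the defining relations, so `φ` is invertible on `U(g)`, and Hom-associativity turns into
associativity of `a * b = φ⁻¹(a) ∨ φ⁻¹(b)`. For this product `U(g)` is the ordinary enveloping
algebra of `g` with the Lie bracket `φ⁻¹[ξ, ξ']`: it is generated by `g` (`adjoin_incl`) and has the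
universal property (`lift`, `algHom_ext`). No basis theorem is needed: maps out come from `lift`,
and identities are tested on generators or by induction along products of generators
(`induction_left`). In particular `Δ` and `ε` are algebra homomorphisms for `*` and the elements of
`g` are primitive, which yields the Hopf laws.

The maps `φ⁻¹(η ▷ ξ)` and `α⁻¹(η ◁ ξ)` form a matched pair of ordinary Lie algebras. The right
action extends to `U(g)` by the universal property. The left action on `U(g)` is forced by `η ▷ (ξ
u) = (η ▷ ξ) u + ξ (η ▷ u) + (η ◁ ξ) ▷ u`, but this recursion has to be shown well defined. For
this, `g` acts on `U(g) × Hom(h, U(g))` in such a way that `u` sends `(1, 0)` to `(u, η ↦ η ▷ u)`;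
the first compatibility condition and the right module law make this a Lie action (`leftRep_lie`).
The second compatibility condition and the left module law make `h` act as a Lie algebra
(`leftAct₁_lie`), hence `U(h)` acts.

Composing these actions with `α` and `φ` gives the Hom-actions. They are unique because the laws
compute them on products of generators. -/

/-- Apply a map to all decorations of a tree. -/
def WTree.map {g h : Type*} (f : g → h) : WTree g → WTree h
  | leaf s ξ => leaf s (f ξ)
  | graft l r => graft (l.map f) (r.map f)

lemma WTree.map_raise {g h : Type*} (f : g → h) (t : WTree g) :
    t.raise.map f = (t.map f).raise := by
  induction t with
  | leaf s ξ => rfl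
  | graft l r hl hr => simp [raise, map, hl, hr]

namespace TreeSpace

variable {K : Type*} [Field K] {g h : Type*}

variable (K) in
/-- Apply a map to all decorations. -/
def map (f : g → h) : TreeSpace K g →ₗ[K] TreeSpace K h :=
  Finsupp.linearCombination K fun t => of (t.map (WTree.map f))

@[simp] lemma map_of (f : g → h) (t : Option (WTree g)) :
    map K f (of t) = of (t.map (WTree.map f)) := by simp [map, of]

lemma map_leaf (f : g → h) (s : ℕ) (ξ : g) : map K f (leaf K s ξ) = leaf K s (f ξ) := by
  simp [leaf, WTree.map]

lemma map_mul (f : g → h) (x y : TreeSpace K g) :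
    map K f (mul K g x y) = mul K h (map K f x) (map K f y) := by
  induction x using induction with
  | hof s =>
    induction y using induction with
    | hof t => cases s <;> cases t <;> simp [WTree.graft₁, WTree.map, WTree.map_raise]
    | hzero => simp
    | hadd x y hx hy => simp [hx, hy]
    | hsmul c x hx => simp [hx]
  | hzero => simp
  | hadd x y hx hy => simp [hx, hy]
  | hsmul c x hx => simp [hx]

lemma map_twist (f : g → h) (x : TreeSpace K g) :
    map K f (twist K g x) = twist K h (map K f x) := by
  rw [← one_mul, map_mul, map_of]
  exact one_mul _

end TreeSpace

namespace HomLie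

variable {K : Type*} [Field K] {g : Type*} [AddCommGroup g] [Module K g]

/-- Relations are natural in the Hom-Lie algebra. This is applied to `φ⁻¹`, to invert the twisting
map on the enveloping algebra. -/
lemma Rel.map {G : HomLie K g} (ψ : g →ₗ[K] g)
    (hb : ∀ ξ ξ', ψ (G.bracket ξ ξ') = G.bracket (ψ ξ) (ψ ξ'))
    (ht : Commute ψ G.twist) {x : TreeSpace K g} (hx : G.Rel x) :
    G.Rel (TreeSpace.map K ψ x) := by
  induction hx with
  | add s ξ ξ' => simpa [TreeSpace.map_leaf] using Rel.add s (ψ ξ) (ψ ξ')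
  | smul s c ξ => simpa [TreeSpace.map_leaf] using Rel.smul s c (ψ ξ)
  | hom_assoc x y z =>
    simpa only [map_sub, TreeSpace.map_mul, TreeSpace.map_twist] using Rel.hom_assoc _ _ _
  | weight s ξ =>
    have h : ψ ((G.twist ^ s) ξ) = (G.twist ^ s) (ψ ξ) := LinearMap.congr_fun (ht.pow_right s) ξ
    simpa only [map_sub, TreeSpace.map_leaf, h] using Rel.weight s (ψ ξ)
  | bracket ξ ξ' =>
    simpa only [map_sub, TreeSpace.map_mul, TreeSpace.map_leaf, hb] using Rel.bracket (ψ ξ) (ψ ξ')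
  | mul_left x y _ ih => simpa only [TreeSpace.map_mul] using Rel.mul_left _ _ ih
  | mul_right x y _ ih => simpa only [TreeSpace.map_mul] using Rel.mul_right _ _ ih

/-! ### Induction over trees and the structure maps on the quotient. -/

/-- The weight relation removes all weights, so `𝟏` and `g` generate under `∨`. Bijectivity of `φ`
plays no role yet; this is what proves that `φ⁻¹` inverts `φ` on the quotient. -/
lemma U_induction (G : HomLie K g) {p : G.U → Prop} (one : p G.uOne)
    (leaf : ∀ ξ, p (G.uLeaf 0 ξ)) (mul : ∀ a b, p a → p b → p (G.uMul a b))
    (add : ∀ a b, p a → p b → p (a + b)) (smul : ∀ (c : K) a, p a → p (c • a)) (u : G.U) :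
    p u := by
  obtain ⟨x, rfl⟩ := G.ideal.mkQ_surjective u
  induction x using TreeSpace.induction with
  | hof t =>
    cases t with
    | none => exact one
    | some t =>
      induction t with
      | leaf s ξ =>
        have h := leaf ((G.twist ^ s) ξ)
        rw [← uLeaf_weight] at h
        exact h
      | graft l r hl hr =>
        have h := mul _ _ hl hr
        rwa [uMul_proj, TreeSpace.mul_of] at h
  -- Zero is reached as `0 • 𝟏`.
  | hzero => simpa using smul 0 _ one
  | hadd x y hx hy => rw [map_add]; exact add _ _ hx hy
  | hsmul c x hx => rw [map_smul]; exact smul _ _ hx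

lemma uTwist_uMul (G : HomLie K g) (a b : G.U) :
    G.uTwist (G.uMul a b) = G.uMul (G.uTwist a) (G.uTwist b) := by
  obtain ⟨x, rfl⟩ := G.ideal.mkQ_surjective a
  obtain ⟨y, rfl⟩ := G.ideal.mkQ_surjective b
  exact congrArg G.proj (TreeSpace.twist_mul x y)

lemma uComul_uMul (G : HomLie K g) (a b : G.U) :
    G.uComul (G.uMul a b) = TensorProduct.map₂ G.uMul G.uMul (G.uComul a) (G.uComul b) := by
  obtain ⟨x, rfl⟩ := G.ideal.mkQ_surjective a
  obtain ⟨y, rfl⟩ := G.ideal.mkQ_surjective b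
  exact (congrArg (TensorProduct.map G.proj G.proj) (TreeSpace.comul_mul x y)).trans
    (G.map_proj_map₂ _ _)

lemma uComul_uTwist (G : HomLie K g) (a : G.U) :
    G.uComul (G.uTwist a) = TensorProduct.map G.uTwist G.uTwist (G.uComul a) := by
  obtain ⟨x, rfl⟩ := G.ideal.mkQ_surjective a
  exact (congrArg (TensorProduct.map G.proj G.proj) (TreeSpace.comul_twist x)).trans
    (G.map_proj_twist _)

lemma uComul_uOne (G : HomLie K g) : G.uComul G.uOne = G.uOne ⊗ₜ G.uOne :=
  congrArg (TensorProduct.map G.proj G.proj) (TreeSpace.comul_of none)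

lemma uComul_uLeaf (G : HomLie K g) (s : ℕ) (ξ : g) :
    G.uComul (G.uLeaf s ξ) = G.uLeaf s ξ ⊗ₜ G.uOne + G.uOne ⊗ₜ G.uLeaf s ξ :=
  G.map_proj_comul_leaf s ξ

lemma uCounit_uMul (G : HomLie K g) (a b : G.U) :
    G.uCounit (G.uMul a b) = G.uCounit a * G.uCounit b := by
  obtain ⟨x, rfl⟩ := G.ideal.mkQ_surjective a
  obtain ⟨y, rfl⟩ := G.ideal.mkQ_surjective b
  exact TreeSpace.counit_mul x y

lemma uCounit_uOne (G : HomLie K g) : G.uCounit G.uOne = 1 := TreeSpace.counit_none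

lemma uCounit_uLeaf (G : HomLie K g) (s : ℕ) (ξ : g) : G.uCounit (G.uLeaf s ξ) = 0 :=
  TreeSpace.counit_some _

lemma uCounit_uTwist (G : HomLie K g) (a : G.U) : G.uCounit (G.uTwist a) = G.uCounit a := by
  rw [← uOne_mul, uCounit_uMul, uCounit_uOne, one_mul]

lemma uAntipode_uMul (G : HomLie K g) (a b : G.U) :
    G.uAntipode (G.uMul a b) = G.uMul (G.uAntipode b) (G.uAntipode a) := by
  obtain ⟨x, rfl⟩ := G.ideal.mkQ_surjective a
  obtain ⟨y, rfl⟩ := G.ideal.mkQ_surjective b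
  exact congrArg G.proj (TreeSpace.antipode_mul x y)

lemma uAntipode_uOne (G : HomLie K g) : G.uAntipode G.uOne = G.uOne :=
  congrArg G.proj (TreeSpace.antipode_of none)

lemma uAntipode_uLeaf (G : HomLie K g) (s : ℕ) (ξ : g) :
    G.uAntipode (G.uLeaf s ξ) = -G.uLeaf s ξ :=
  (congrArg G.proj (TreeSpace.antipode_of _)).trans (map_neg _ _)

lemma uAntipode_uTwist (G : HomLie K g) (a : G.U) :
    G.uAntipode (G.uTwist a) = G.uTwist (G.uAntipode a) := by
  rw [← uOne_mul, uAntipode_uMul, uAntipode_uOne, mul_uOne]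

/-- The inclusion of `g`. -/
def incl (G : HomLie K g) : g →ₗ[K] G.U := G.uLeaf 0

lemma uTwist_incl (G : HomLie K g) (ξ : g) : G.uTwist (G.incl ξ) = G.incl (G.twist ξ) := G.uTwist_uLeaf 0 ξ

lemma uLeaf_eq_incl (G : HomLie K g) (s : ℕ) (ξ : g) : G.uLeaf s ξ = G.incl ((G.twist ^ s) ξ) :=
  G.uLeaf_weight s ξ

lemma uCounit_incl (G : HomLie K g) (ξ : g) : G.uCounit (G.incl ξ) = 0 := G.uCounit_uLeaf 0 ξ

lemma uAntipode_incl (G : HomLie K g) (ξ : g) : G.uAntipode (G.incl ξ) = -G.incl ξ := G.uAntipode_uLeaf 0 ξ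

/-! ### The associative product for a bijective twisting map -/

/-- A Hom-Lie algebra is regular if its twisting map is bijective. -/
class IsRegular (G : HomLie K g) : Prop where
  bijective : Function.Bijective G.twist

variable (G : HomLie K g) [hG : G.IsRegular]

/-- The twisting map of a regular Hom-Lie algebra as an equivalence. -/
def twistEquiv : g ≃ₗ[K] g := LinearEquiv.ofBijective G.twist hG.bijective

@[simp] lemma twist_symm (ξ : g) : G.twist (G.twistEquiv.symm ξ) = ξ :=
  G.twistEquiv.apply_symm_apply ξ

@[simp] lemma symm_twist (ξ : g) : G.twistEquiv.symm (G.twist ξ) = ξ :=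
  G.twistEquiv.symm_apply_apply ξ

lemma symm_bracket (ξ ξ' : g) : G.twistEquiv.symm (G.bracket ξ ξ') =
    G.bracket (G.twistEquiv.symm ξ) (G.twistEquiv.symm ξ') := by
  apply hG.bijective.1
  simp [twist_bracket]

/-- The inverse of the twisting map of the enveloping algebra. -/
def uTwistInv : G.U →ₗ[K] G.U :=
  G.ideal.mapQ G.ideal (TreeSpace.map K G.twistEquiv.symm)
    (Submodule.span_le.2 fun _ hx => Submodule.subset_span
      (Rel.map (G.twistEquiv.symm : g →ₗ[K] g) G.symm_bracket
        (LinearMap.ext fun ξ => by simp) hx))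

lemma uTwistInv_uOne : G.uTwistInv G.uOne = G.uOne := congrArg G.proj (TreeSpace.map_of _ none)

lemma uTwistInv_uLeaf (s : ℕ) (ξ : g) :
    G.uTwistInv (G.uLeaf s ξ) = G.uLeaf s (G.twistEquiv.symm ξ) :=
  congrArg G.proj (TreeSpace.map_leaf _ s ξ)

lemma uTwistInv_uMul (a b : G.U) :
    G.uTwistInv (G.uMul a b) = G.uMul (G.uTwistInv a) (G.uTwistInv b) := by
  obtain ⟨x, rfl⟩ := G.ideal.mkQ_surjective a
  obtain ⟨y, rfl⟩ := G.ideal.mkQ_surjective b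
  exact congrArg G.proj (TreeSpace.map_mul _ x y)

@[simp] lemma uTwist_uTwistInv (a : G.U) : G.uTwist (G.uTwistInv a) = a := by
  induction a using G.U_induction with
  | one => rw [uTwistInv_uOne, uTwist_uOne]
  | leaf ξ => rw [uTwistInv_uLeaf, uTwist_uLeaf, twist_symm]
  | mul a b ha hb => rw [uTwistInv_uMul, uTwist_uMul, ha, hb]
  | add a b ha hb => rw [map_add, map_add, ha, hb]
  | smul c a ha => rw [map_smul, map_smul, ha]

@[simp] lemma uTwistInv_uTwist (a : G.U) : G.uTwistInv (G.uTwist a) = a := by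
  induction a using G.U_induction with
  | one => rw [uTwist_uOne, uTwistInv_uOne]
  | leaf ξ => rw [uTwist_uLeaf, uTwistInv_uLeaf, symm_twist]
  | mul a b ha hb => rw [uTwist_uMul, uTwistInv_uMul, ha, hb]
  | add a b ha hb => rw [map_add, map_add, ha, hb]
  | smul c a ha => rw [map_smul, map_smul, ha]

/-- For a bijective twisting map `φ`, the product `φ⁻¹(a) ∨ φ⁻¹(b)` makes the enveloping algebra
an associative algebra. -/
instance : Ring G.U where
  __ := (inferInstance : AddCommGroup G.U)
  mul a b := G.uMul (G.uTwistInv a) (G.uTwistInv b)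
  one := G.uOne
  left_distrib a b c := by
    change G.uMul _ (G.uTwistInv (b + c)) = G.uMul _ _ + G.uMul _ _
    rw [map_add, map_add]
  right_distrib a b c := by
    change G.uMul (G.uTwistInv (a + b)) _ = G.uMul _ _ + G.uMul _ _
    rw [map_add, map_add, LinearMap.add_apply]
  zero_mul a := by
    change G.uMul (G.uTwistInv 0) _ = 0
    rw [map_zero, map_zero, LinearMap.zero_apply]
  mul_zero a := by
    change G.uMul _ (G.uTwistInv 0) = 0
    rw [map_zero, map_zero]
  mul_assoc a b c := by
    change G.uMul (G.uTwistInv (G.uMul _ _)) _ = G.uMul _ (G.uTwistInv (G.uMul _ _))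
    -- Both bracketings of `a * b * c` carry `φ⁻²` on the two inner factors and `φ⁻¹` on the outer
    -- one, so Hom-associativity is used at the `φ⁻²`-preimages.
    have h := G.uMul_assoc (G.uTwistInv (G.uTwistInv a)) (G.uTwistInv (G.uTwistInv b))
      (G.uTwistInv (G.uTwistInv c))
    rw [uTwist_uTwistInv, uTwist_uTwistInv] at h
    rw [uTwistInv_uMul, uTwistInv_uMul, h]
  one_mul a := by
    change G.uMul (G.uTwistInv G.uOne) _ = a
    rw [uTwistInv_uOne, uOne_mul, uTwist_uTwistInv]
  mul_one a := by
    change G.uMul _ (G.uTwistInv G.uOne) = a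
    rw [uTwistInv_uOne, mul_uOne, uTwist_uTwistInv]

lemma mul_def (a b : G.U) : a * b = G.uMul (G.uTwistInv a) (G.uTwistInv b) := rfl

lemma uOne_eq : G.uOne = 1 := rfl

instance : Algebra K G.U :=
  Algebra.ofModule
    (fun c a b => by rw [mul_def, mul_def, map_smul, map_smul, LinearMap.smul_apply])
    (fun c a b => by rw [mul_def, mul_def, map_smul, map_smul])

lemma uTwist_mul (a b : G.U) : G.uTwist (a * b) = G.uTwist a * G.uTwist b := by
  rw [mul_def, mul_def, uTwist_uMul]; simp

lemma uMul_eq (a b : G.U) : G.uMul a b = G.uTwist a * G.uTwist b := by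
  rw [mul_def]; simp

lemma uMul_eq' (a b : G.U) : G.uMul a b = G.uTwist (a * b) := by rw [uMul_eq, uTwist_mul]

/-- The twisting map as an algebra endomorphism for the associative product. -/
def uTwistHom : G.U →ₐ[K] G.U := AlgHom.ofLinearMap G.uTwist G.uTwist_uOne G.uTwist_mul

@[simp] lemma uTwistHom_apply (a : G.U) : G.uTwistHom a = G.uTwist a := rfl

/-- The untwisted bracket `φ⁻¹[ξ, ξ']`, a Lie bracket. -/
def lie (ξ ξ' : g) : g := G.twistEquiv.symm (G.bracket ξ ξ')

/-- The bracket relation for `φ⁻¹ξ` and `φ⁻¹ξ'`, read in terms of `*`. -/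
lemma incl_lie (ξ ξ' : g) :
    G.incl (G.lie ξ ξ') = G.incl ξ * G.incl ξ' - G.incl ξ' * G.incl ξ := by
  simp only [incl, lie, mul_def, symm_bracket, uTwistInv_uLeaf, uLeaf_bracket]

lemma twist_lie (ξ ξ' : g) : G.twist (G.lie ξ ξ') = G.lie (G.twist ξ) (G.twist ξ') := by
  rw [lie, lie, ← twist_bracket]; simp

/-- The subalgebra generated by `g` is stable under `φ`, and `a ∨ b = φ(a) * φ(b)`; hence it is
closed under `∨` and contains all trees. -/
lemma adjoin_incl : Algebra.adjoin K (Set.range G.incl) = ⊤ := by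
  set S := Algebra.adjoin K (Set.range G.incl) with hS
  have incl_mem (ξ : g) : G.incl ξ ∈ S := Algebra.subset_adjoin ⟨ξ, rfl⟩
  have hle : S ≤ S.comap G.uTwistHom := by
    refine Algebra.adjoin_le ?_
    rintro _ ⟨ξ, rfl⟩
    simpa [uTwist_incl] using incl_mem _
  refine eq_top_iff.2 fun u _ => ?_
  induction u using G.U_induction with
  | one => exact one_mem S
  | leaf ξ => exact incl_mem ξ
  | mul a b ha hb =>
    rw [uMul_eq]
    exact mul_mem (hle (ha trivial)) (hle (hb trivial))
  | add a b ha hb => exact add_mem (ha trivial) (hb trivial)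
  | smul c a ha => exact S.smul_mem (ha trivial) c

lemma algHom_ext {A : Type*} [Semiring A] [Algebra K A] {f f' : G.U →ₐ[K] A}
    (h : ∀ ξ, f (G.incl ξ) = f' (G.incl ξ)) : f = f' :=
  AlgHom.ext_of_adjoin_eq_top G.adjoin_incl (by rintro _ ⟨ξ, rfl⟩; exact h ξ)

/-- Membership in the generated subalgebra gives induction over arbitrary products. Proving instead
that multiplication by `u` preserves `p` reduces these to one generator at a time. -/
lemma induction_left {p : G.U → Prop} (one : p 1) (mul : ∀ ξ u, p u → p (G.incl ξ * u))
    (add : ∀ a b, p a → p b → p (a + b)) (smul : ∀ (c : K) a, p a → p (c • a)) (u : G.U) :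
    p u := by
  suffices h : ∀ v, p v → p (u * v) by simpa using h 1 one
  have hu : u ∈ Algebra.adjoin K (Set.range G.incl) := by rw [adjoin_incl]; trivial
  induction hu using Algebra.adjoin_induction with
  | mem x hx => obtain ⟨ξ, rfl⟩ := hx; exact mul ξ
  | algebraMap c => intro v hv; rw [← Algebra.smul_def]; exact smul c v hv
  | add x y _ _ hx hy => intro v hv; rw [add_mul]; exact add _ _ (hx v hv) (hy v hv)
  | mul x y _ _ hx hy => intro v hv; rw [mul_assoc]; exact hx _ (hy v hv)

lemma induction_right {p : G.U → Prop} (one : p 1) (mul : ∀ u ξ, p u → p (u * G.incl ξ))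
    (add : ∀ a b, p a → p b → p (a + b)) (smul : ∀ (c : K) a, p a → p (c • a)) (u : G.U) :
    p u := by
  suffices h : ∀ v, p v → p (v * u) by simpa using h 1 one
  have hu : u ∈ Algebra.adjoin K (Set.range G.incl) := by rw [adjoin_incl]; trivial
  induction hu using Algebra.adjoin_induction with
  | mem x hx => obtain ⟨ξ, rfl⟩ := hx; exact fun v hv => mul v ξ hv
  | algebraMap c =>
    intro v hv; rw [← Algebra.commutes, ← Algebra.smul_def]; exact smul c v hv
  | add x y _ _ hx hy => intro v hv; rw [mul_add]; exact add _ _ (hx v hv) (hy v hv)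
  | mul x y _ _ hx hy => intro v hv; rw [← mul_assoc]; exact hy _ (hx v hv)

end HomLie

/-! ### The universal property -/

section Lift

variable {K : Type*} [Field K] {g : Type*} [AddCommGroup g] [Module K g]
  {A : Type*} [Ring A] [Algebra K A]

/-- Evaluation of trees in an associative algebra: leaves are evaluated by `f`, and the twisting
map `φ` is applied once for every grafting a leaf takes part in. -/
def WTree.eval (φ : g →ₗ[K] g) : WTree g → (g →ₗ[K] A) → A
  | leaf s ξ, f => f ((φ ^ s) ξ)
  | graft l r, f => l.eval φ (f ∘ₗ φ) * r.eval φ (f ∘ₗ φ)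

lemma WTree.eval_raise (φ : g →ₗ[K] g) (t : WTree g) (f : g →ₗ[K] A) :
    t.raise.eval φ f = t.eval φ (f ∘ₗ φ) := by
  induction t generalizing f with
  | leaf s ξ => simp [raise, eval, pow_succ']
  | graft l r hl hr => simp [raise, eval, hl, hr]

/-- Evaluation on `𝟏` and trees. -/
def WTree.eval₁ (φ : g →ₗ[K] g) (f : g →ₗ[K] A) : Option (WTree g) → A
  | none => 1
  | some t => t.eval φ f

namespace TreeSpace

/-- The linear extension of the evaluation of trees. -/
def eval (φ : g →ₗ[K] g) (f : g →ₗ[K] A) : TreeSpace K g →ₗ[K] A :=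
  Finsupp.linearCombination K (WTree.eval₁ φ f)

@[simp] lemma eval_of (φ : g →ₗ[K] g) (f : g →ₗ[K] A) (t : Option (WTree g)) :
    eval φ f (of t) = WTree.eval₁ φ f t := by simp [eval, of]

lemma eval_leaf (φ : g →ₗ[K] g) (f : g →ₗ[K] A) (s : ℕ) (ξ : g) :
    eval φ f (leaf K s ξ) = f ((φ ^ s) ξ) := eval_of φ f _

lemma eval_twist (φ : g →ₗ[K] g) (f : g →ₗ[K] A) (x : TreeSpace K g) :
    eval φ f (twist K g x) = eval φ (f ∘ₗ φ) x := by
  induction x using induction with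
  | hof t => cases t <;> simp [WTree.raise₁, WTree.eval₁, WTree.eval_raise]
  | hzero => simp
  | hadd x y hx hy => simp [hx, hy]
  | hsmul c x hx => simp [hx]

lemma eval_mul (φ : g →ₗ[K] g) (f : g →ₗ[K] A) (x y : TreeSpace K g) :
    eval φ f (mul K g x y) = eval φ (f ∘ₗ φ) x * eval φ (f ∘ₗ φ) y := by
  induction x using induction with
  | hof s =>
    induction y using induction with
    | hof t =>
      cases s <;> cases t <;> simp [WTree.graft₁, WTree.eval₁, WTree.eval_raise, WTree.eval]
    | hzero => simp
    | hadd x y hx hy => simp [hx, hy, mul_add]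
    | hsmul c x hx => simp [hx]
  | hzero => simp
  | hadd x y hx hy => simp [hx, hy, add_mul]
  | hsmul c x hx => simp [hx]

end TreeSpace

namespace HomLie

variable (G : HomLie K g) [hG : G.IsRegular]

/-- Evaluating a product replaces `f` by `f ∘ φ`, which again takes the untwisted bracket to
commutators since `φ` preserves that bracket. The induction therefore runs over all such `f` at
once; the target algebra needs no twisting map of its own. -/
lemma eval_rel (f : g →ₗ[K] A) (hf : ∀ ξ ξ', f (G.lie ξ ξ') = f ξ * f ξ' - f ξ' * f ξ)
    {x : TreeSpace K g} (hx : G.Rel x) : TreeSpace.eval G.twist f x = 0 := by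
  induction hx generalizing f with
  | add s ξ ξ' => simp [TreeSpace.eval_leaf]
  | smul s c ξ => simp [TreeSpace.eval_leaf]
  | hom_assoc x y z => simp [TreeSpace.eval_mul, TreeSpace.eval_twist, mul_assoc]
  | weight s ξ => simp [TreeSpace.eval_leaf]
  | bracket ξ ξ' =>
    have h := hf (G.twist ξ) (G.twist ξ')
    rw [lie, ← twist_bracket, symm_twist] at h
    simp [TreeSpace.eval_mul, TreeSpace.eval_leaf, h]
  | mul_left x y _ ih =>
    rw [TreeSpace.eval_mul, ih (f ∘ₗ G.twist), mul_zero]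
    intro ξ ξ'
    simp [twist_lie, hf]
  | mul_right x y _ ih =>
    rw [TreeSpace.eval_mul, ih (f ∘ₗ G.twist), zero_mul]
    intro ξ ξ'
    simp [twist_lie, hf]

/-- The algebra homomorphism on the enveloping algebra (with its associative product) extending a
linear map on `g` that takes the untwisted bracket to the commutator. -/
def lift (f : g →ₗ[K] A) (hf : ∀ ξ ξ', f (G.lie ξ ξ') = f ξ * f ξ' - f ξ' * f ξ) :
    G.U →ₐ[K] A :=
  AlgHom.ofLinearMap
    (G.ideal.liftQ (TreeSpace.eval G.twist f)
      (Submodule.span_le.2 fun _ hx => G.eval_rel f hf hx))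
    (TreeSpace.eval_of _ _ none)
    (fun a b => by
      -- Evaluation is known on `∨`, and `φ(a) * φ(b) = a ∨ b`; surjectivity of `φ` makes all
      -- products of this form.
      obtain ⟨a, rfl⟩ := (Function.LeftInverse.surjective G.uTwist_uTwistInv) a
      obtain ⟨b, rfl⟩ := (Function.LeftInverse.surjective G.uTwist_uTwistInv) b
      rw [← uMul_eq]
      obtain ⟨x, rfl⟩ := G.ideal.mkQ_surjective a
      obtain ⟨y, rfl⟩ := G.ideal.mkQ_surjective b
      change TreeSpace.eval _ _ (TreeSpace.mul K g x y) =
        TreeSpace.eval _ _ (TreeSpace.twist K g x) * TreeSpace.eval _ _ (TreeSpace.twist K g y)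
      rw [TreeSpace.eval_mul, TreeSpace.eval_twist, TreeSpace.eval_twist])

@[simp] lemma lift_incl (f : g →ₗ[K] A)
    (hf : ∀ ξ ξ', f (G.lie ξ ξ') = f ξ * f ξ' - f ξ' * f ξ) (ξ : g) :
    G.lift f hf (G.incl ξ) = f ξ :=
  TreeSpace.eval_leaf _ _ 0 ξ

end HomLie

end Lift

/-! ### The Hom-Hopf algebra -/

namespace HomLie

variable {K : Type*} [Field K] {g : Type*} [AddCommGroup g] [Module K g]
variable (G : HomLie K g) [hG : G.IsRegular]

lemma map₂_uMul (z w : G.U ⊗[K] G.U) : TensorProduct.map₂ G.uMul G.uMul z w =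
    TensorProduct.map G.uTwist G.uTwist z * TensorProduct.map G.uTwist G.uTwist w := by
  induction z with
  | zero => simp
  | add a b ha hb => simp only [map_add, LinearMap.add_apply, ha, hb, add_mul]
  | tmul a b =>
    induction w with
    | zero => simp
    | add a b ha hb => simp only [map_add, ha, hb, mul_add]
    | tmul c d => simp [uMul_eq]

/-- The coproduct as an algebra homomorphism. -/
def comulHom : G.U →ₐ[K] G.U ⊗[K] G.U :=
  AlgHom.ofLinearMap G.uComul G.uComul_uOne fun a b => by
    rw [mul_def, uComul_uMul, map₂_uMul, ← uComul_uTwist, ← uComul_uTwist, uTwist_uTwistInv,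
      uTwist_uTwistInv]

@[simp] lemma comulHom_apply (a : G.U) : G.comulHom a = G.uComul a := rfl

lemma uComul_one : G.uComul 1 = 1 := map_one G.comulHom

lemma uComul_mul (a b : G.U) : G.uComul (a * b) = G.uComul a * G.uComul b :=
  map_mul G.comulHom a b

lemma uComul_incl (ξ : g) :
    G.uComul (G.incl ξ) = G.incl ξ ⊗ₜ (1 : G.U) + (1 : G.U) ⊗ₜ G.incl ξ :=
  G.uComul_uLeaf 0 ξ

/-- The counit as an algebra homomorphism. -/
def counitHom : G.U →ₐ[K] K :=
  AlgHom.ofLinearMap G.uCounit G.uCounit_uOne fun a b => by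
    rw [mul_def, uCounit_uMul, ← uCounit_uTwist, ← G.uCounit_uTwist (G.uTwistInv b),
      uTwist_uTwistInv, uTwist_uTwistInv]

@[simp] lemma counitHom_apply (a : G.U) : G.counitHom a = G.uCounit a := rfl

lemma uCounit_one : G.uCounit 1 = 1 := map_one G.counitHom

lemma uCounit_mul (a b : G.U) : G.uCounit (a * b) = G.uCounit a * G.uCounit b :=
  map_mul G.counitHom a b

lemma uAntipode_one : G.uAntipode 1 = 1 := G.uAntipode_uOne

lemma uAntipode_mul (a b : G.U) : G.uAntipode (a * b) = G.uAntipode b * G.uAntipode a := by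
  rw [mul_def, uAntipode_uMul, uMul_eq, ← uAntipode_uTwist, ← uAntipode_uTwist,
    uTwist_uTwistInv, uTwist_uTwistInv]

/-- Both sides are algebra homomorphisms in `u`, so only primitive generators need checking. The
counit laws follow the same pattern. -/
lemma comul_coassoc (u : G.U) : TensorProduct.map LinearMap.id G.uComul (G.uComul u) =
    TensorProduct.assoc K G.U G.U G.U (TensorProduct.map G.uComul LinearMap.id (G.uComul u)) := by
  have h : (Algebra.TensorProduct.map (AlgHom.id K G.U) G.comulHom).comp G.comulHom =
      ((Algebra.TensorProduct.assoc K K K G.U G.U G.U).toAlgHom.comp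
        (Algebra.TensorProduct.map G.comulHom (AlgHom.id K G.U))).comp G.comulHom := by
    refine G.algHom_ext fun ξ => ?_
    simp [uComul_incl, uComul_one, TensorProduct.tmul_add, TensorProduct.add_tmul,
      Algebra.TensorProduct.one_def, add_assoc]
  exact DFunLike.congr_fun h u

lemma comul_counit_left (u : G.U) :
    TensorProduct.map G.uCounit LinearMap.id (G.uComul u) = (1 : K) ⊗ₜ[K] u := by
  have h : (Algebra.TensorProduct.map G.counitHom (AlgHom.id K G.U)).comp G.comulHom =
      Algebra.TensorProduct.includeRight := by
    refine G.algHom_ext fun ξ => ?_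
    simp [uComul_incl, uCounit_incl, uCounit_one]
  exact DFunLike.congr_fun h u

lemma comul_counit_right (u : G.U) :
    TensorProduct.map LinearMap.id G.uCounit (G.uComul u) = u ⊗ₜ[K] (1 : K) := by
  have h : (Algebra.TensorProduct.map (AlgHom.id K G.U) G.counitHom).comp G.comulHom =
      Algebra.TensorProduct.includeLeft := by
    refine G.algHom_ext fun ξ => ?_
    simp [uComul_incl, uCounit_incl, uCounit_one]
  exact DFunLike.congr_fun h u

/-- Reduces the antipode laws for `∨` to those for `*`, because `φ` fixes `𝟏`. -/
lemma lift_uMul (z : G.U ⊗[K] G.U) :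
    TensorProduct.lift G.uMul z = G.uTwist (LinearMap.mul' K G.U z) := by
  induction z with
  | zero => simp
  | add a b ha hb => simp only [map_add, ha, hb]
  | tmul a b => simp [uMul_eq']

/-- On `ξ u`, each summand `a ⊗ b` of `Δ(u)` contributes `S(ξ a) b + S(a) ξ b = -S(a) ξ b + S(a) ξ b
= 0`; no induction hypothesis enters. -/
lemma mul_antipode_left (u : G.U) :
    LinearMap.mul' K G.U (TensorProduct.map G.uAntipode LinearMap.id (G.uComul u)) =
      G.uCounit u • 1 := by
  induction u using G.induction_left with
  | one => simp [uComul_one, Algebra.TensorProduct.one_def, uAntipode_one, uCounit_one]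
  | mul ξ u _ =>
    rw [uComul_mul, uCounit_mul, uCounit_incl, zero_mul, zero_smul, uComul_incl]
    induction G.uComul u with
    | zero => simp
    | add a b ha hb => rw [mul_add, map_add, map_add, ha, hb, add_zero]
    | tmul a b => simp [add_mul, uAntipode_mul, uAntipode_incl, mul_assoc]
  | add a b ha hb => simp only [map_add, ha, hb, add_smul]
  | smul c a ha => simp only [map_smul, ha, smul_assoc]

/-- The same cancellation, which now needs the generator on the right: `a ξ S(b) + a S(b ξ) = 0`. -/
lemma mul_antipode_right (u : G.U) :
    LinearMap.mul' K G.U (TensorProduct.map LinearMap.id G.uAntipode (G.uComul u)) =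
      G.uCounit u • 1 := by
  induction u using G.induction_right with
  | one => simp [uComul_one, Algebra.TensorProduct.one_def, uAntipode_one, uCounit_one]
  | mul u ξ _ =>
    rw [uComul_mul, uCounit_mul, uCounit_incl, mul_zero, zero_smul, uComul_incl]
    induction G.uComul u with
    | zero => simp
    | add a b ha hb => rw [add_mul, map_add, map_add, ha, hb, add_zero]
    | tmul a b => simp [mul_add, uAntipode_mul, uAntipode_incl, mul_assoc]
  | add a b ha hb => simp only [map_add, ha, hb, add_smul]
  | smul c a ha => simp only [map_smul, ha, smul_assoc]

theorem env_isHomHopf : G.env.IsHomHopf where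
  bialgebra :=
    { algebra := ⟨fun x y z => (G.uMul_assoc x y z).symm, G.uOne_mul, G.mul_uOne, G.uTwist_uOne⟩
      coalgebra := ⟨G.comul_coassoc, G.comul_counit_left, G.comul_counit_right, fun _ => rfl⟩
      comul_one := G.uComul_uOne
      comul_mul := G.uComul_uMul
      comul_twist := G.uComul_uTwist
      counit_one := G.uCounit_uOne
      counit_mul := G.uCounit_uMul
      counit_twist := G.uCounit_uTwist
      cotwist_one := rfl
      cotwist_mul := fun _ _ => rfl
      cotwist_twist := fun _ => rfl }
  antipode_left x := by
    refine (G.lift_uMul _).trans ?_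
    exact (congrArg G.uTwist (G.mul_antipode_left x)).trans (by
      rw [map_smul, ← uOne_eq, uTwist_uOne]; rfl)
  antipode_right x := by
    refine (G.lift_uMul _).trans ?_
    exact (congrArg G.uTwist (G.mul_antipode_right x)).trans (by
      rw [map_smul, ← uOne_eq, uTwist_uOne]; rfl)
  antipode_twist := G.uAntipode_uTwist
  antipode_cotwist _ := rfl

end HomLie

/-! ### The untwisted actions -/

namespace HomLieMatchedPair

variable {K : Type*} [Field K] {g h : Type*} [AddCommGroup g] [Module K g]
  [AddCommGroup h] [Module K h] {G : HomLie K g} {H : HomLie K h}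
  [hG : G.IsRegular] [hH : H.IsRegular] (P : HomLieMatchedPair G H)

/-! ### The untwisted matched pair of Lie algebras. -/

/-- The untwisted left action `φ⁻¹(η ▷ ξ)`, an action of Lie algebras. -/
def l : h →ₗ[K] g →ₗ[K] g := P.left.compr₂ (G.twistEquiv.symm : g →ₗ[K] g)

/-- The untwisted right action `α⁻¹(η ◁ ξ)`, an action of Lie algebras. -/
def r : h →ₗ[K] g →ₗ[K] h := P.right.compr₂ (H.twistEquiv.symm : h →ₗ[K] h)

omit hH in
lemma l_apply (η : h) (ξ : g) : P.l η ξ = G.twistEquiv.symm (P.left η ξ) := rfl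

omit hG in
lemma r_apply (η : h) (ξ : g) : P.r η ξ = H.twistEquiv.symm (P.right η ξ) := rfl

lemma l_lie (η η' : h) (ξ : g) :
    P.l (H.lie η η') ξ = P.l η (P.l η' ξ) - P.l η' (P.l η ξ) := by
  -- Each side is a twofold operation with two inverse twists; applying `φ` twice clears both. The
  -- next three lemmas do the same.
  apply hG.bijective.1
  apply hG.bijective.1
  simp [l_apply, HomLie.lie, twist_left, bracket_left]

lemma r_lie (η : h) (ξ ξ' : g) :
    P.r η (G.lie ξ ξ') = P.r (P.r η ξ) ξ' - P.r (P.r η ξ') ξ := by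
  apply hH.bijective.1
  apply hH.bijective.1
  simp [r_apply, HomLie.lie, twist_right, right_bracket]

lemma l_compat (η : h) (ξ ξ' : g) : P.l η (G.lie ξ ξ') =
    G.lie (P.l η ξ) ξ' + G.lie ξ (P.l η ξ') + P.l (P.r η ξ) ξ' - P.l (P.r η ξ') ξ := by
  apply hG.bijective.1
  apply hG.bijective.1
  simp [l_apply, r_apply, HomLie.lie, twist_left, left_compat, HomLie.twist_bracket]

lemma r_compat (η η' : h) (ξ : g) : P.r (H.lie η η') ξ =
    H.lie η (P.r η' ξ) + H.lie (P.r η ξ) η' + P.r η (P.l η' ξ) - P.r η' (P.l η ξ) := by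
  apply hH.bijective.1
  apply hH.bijective.1
  simp [l_apply, r_apply, HomLie.lie, twist_right, right_compat, HomLie.twist_bracket]

omit hH in
lemma twist_l (η : h) (ξ : g) : G.twist (P.l η ξ) = P.l (H.twist η) (G.twist ξ) := by
  simp [l_apply, ← twist_left]

omit hG in
lemma twist_r (η : h) (ξ : g) : H.twist (P.r η ξ) = P.r (H.twist η) (G.twist ξ) := by
  simp [r_apply, ← twist_right]

/-! ### The action of `U(g)` on `h`. -/

/-- The right module structure on `h` over the enveloping algebra of `g` with its associative
product, as a homomorphism of algebras. -/
def rightHom : G.U →ₐ[K] (Module.End K h)ᵐᵒᵖ :=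
  G.lift ((MulOpposite.opLinearEquiv K : Module.End K h ≃ₗ[K] _).toLinearMap ∘ₗ P.r.flip)
    fun ξ ξ' => by
      apply MulOpposite.unop_injective
      ext η
      simp [r_lie]

/-- The right module structure on `h` over the enveloping algebra of `g` with its associative
product. -/
def rightAct : G.U →ₗ[K] Module.End K h :=
  (MulOpposite.opLinearEquiv K : Module.End K h ≃ₗ[K] _).symm.toLinearMap ∘ₗ
    P.rightHom.toLinearMap

@[simp] lemma rightAct_one (η : h) : P.rightAct 1 η = η := by simp [rightAct]

lemma rightAct_mul (u v : G.U) (η : h) :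
    P.rightAct (u * v) η = P.rightAct v (P.rightAct u η) := by simp [rightAct]

@[simp] lemma rightAct_incl (ξ : g) (η : h) : P.rightAct (G.incl ξ) η = P.r η ξ := by
  simp [rightAct, rightHom]

lemma twist_rightAct (u : G.U) (η : h) :
    H.twist (P.rightAct u η) = P.rightAct (G.uTwist u) (H.twist η) := by
  induction u using G.induction_left generalizing η with
  | one => rw [← G.uOne_eq, G.uTwist_uOne, G.uOne_eq, rightAct_one, rightAct_one]
  | mul ξ u hu =>
    rw [HomLie.uTwist_mul, HomLie.uTwist_incl, rightAct_mul, rightAct_mul, hu, rightAct_incl,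
      rightAct_incl, twist_r]
  | add a b ha hb => simp only [map_add, LinearMap.add_apply, ha, hb]
  | smul c a ha => simp only [map_smul, LinearMap.smul_apply, ha]

/-! ### The action of `U(h)` on `U(g)`. -/

/-- The action of `g` on `U(g) × Hom(h, U(g))` by
`ξ (u, m) = (ξ u, η ↦ (η ▷ ξ) u + ξ m(η) + m(η ◁ ξ))`. -/
def leftRep : g →ₗ[K] Module.End K (G.U × (h →ₗ[K] G.U)) :=
  LinearMap.mk₂ K
    (fun ξ x => (G.incl ξ * x.1, LinearMap.mulRight K x.1 ∘ₗ G.incl ∘ₗ P.l.flip ξ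
      + LinearMap.mulLeft K (G.incl ξ) ∘ₗ x.2 + x.2 ∘ₗ P.r.flip ξ))
    (fun ξ ξ' x => by
      ext
      · simp [add_mul]
      · simp [add_mul]; abel)
    (fun c ξ x => by ext <;> simp)
    (fun ξ x x' => by
      ext
      · simp [mul_add]
      · simp [mul_add]; abel)
    (fun c ξ x => by ext <;> simp)

lemma leftRep_fst (ξ : g) (x : G.U × (h →ₗ[K] G.U)) : (P.leftRep ξ x).1 = G.incl ξ * x.1 := rfl

lemma leftRep_snd (ξ : g) (x : G.U × (h →ₗ[K] G.U)) (η : h) : (P.leftRep ξ x).2 η =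
    G.incl (P.l η ξ) * x.1 + G.incl ξ * x.2 η + x.2 (P.r η ξ) := rfl

/-- In the second component, `l_compat` splits `η ▷ [ξ, ξ']` and `r_lie` splits `η ◁ [ξ, ξ']`; the
mixed terms cancel in the commutator. -/
lemma leftRep_lie (ξ ξ' : g) :
    P.leftRep (G.lie ξ ξ') = P.leftRep ξ * P.leftRep ξ' - P.leftRep ξ' * P.leftRep ξ := by
  refine LinearMap.ext fun x => Prod.ext ?_ (LinearMap.ext fun η => ?_)
  · simp only [LinearMap.sub_apply, Module.End.mul_apply, Prod.fst_sub, leftRep_fst,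
      HomLie.incl_lie, sub_mul, mul_assoc]
  · simp only [LinearMap.sub_apply, Module.End.mul_apply, Prod.snd_sub, leftRep_snd, leftRep_fst,
      HomLie.incl_lie, l_compat, r_lie, map_add, map_sub]
    noncomm_ring

/-- The action of the enveloping algebra of `g` on `U(g) × Hom(h, U(g))`. -/
def leftRepHom : G.U →ₐ[K] Module.End K (G.U × (h →ₗ[K] G.U)) :=
  G.lift (A := Module.End K (G.U × (h →ₗ[K] G.U))) P.leftRep P.leftRep_lie

/-- The untwisted action of elements of `h` on the enveloping algebra of `g`. -/
def leftAct₁ : h →ₗ[K] Module.End K G.U :=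
  (LinearMap.snd K G.U (h →ₗ[K] G.U) ∘ₗ LinearMap.applyₗ ((1, 0) : G.U × (h →ₗ[K] G.U)) ∘ₗ
    P.leftRepHom.toLinearMap).flip

lemma leftAct₁_apply (η : h) (u : G.U) : P.leftAct₁ η u = (P.leftRepHom u (1, 0)).2 η := rfl

/-- The first component keeps track of `u` itself, which the recursion for the second component
consumes. -/
lemma leftRepHom_fst (u : G.U) (x : G.U × (h →ₗ[K] G.U)) : (P.leftRepHom u x).1 = u * x.1 := by
  induction u using G.induction_left with
  | one => simp
  | mul ξ u hu => simp [leftRepHom, leftRep_fst, mul_assoc] at hu ⊢; rw [hu]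
  | add a b ha hb => simp [ha, hb, add_mul]
  | smul c a ha => simp [ha]

@[simp] lemma leftAct₁_one (η : h) : P.leftAct₁ η 1 = 0 := by simp [leftAct₁_apply]

/-- The defining recursion of the action; together with the vanishing on `1` it drives every later
induction. -/
lemma leftAct₁_incl_mul (η : h) (ξ : g) (u : G.U) : P.leftAct₁ η (G.incl ξ * u) =
    G.incl (P.l η ξ) * u + G.incl ξ * P.leftAct₁ η u + P.leftAct₁ (P.r η ξ) u := by
  have h : P.leftRepHom (G.incl ξ) = P.leftRep ξ := G.lift_incl _ _ ξ
  rw [leftAct₁_apply, map_mul, Module.End.mul_apply, h, leftRep_snd, leftRepHom_fst, mul_one]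
  rfl

lemma leftAct₁_incl (η : h) (ξ : g) : P.leftAct₁ η (G.incl ξ) = G.incl (P.l η ξ) := by
  simpa using P.leftAct₁_incl_mul η ξ 1

/-- After expanding `ξ u`, `r_compat` rewrites `[η, η'] ◁ ξ`. Its bracket terms call for the
hypothesis at the pairs `η, η' ◁ ξ` and `η ◁ ξ, η'`, so both elements of `h` vary in the induction.
-/
lemma leftAct₁_lie (η η' : h) (u : G.U) : P.leftAct₁ (H.lie η η') u =
    P.leftAct₁ η (P.leftAct₁ η' u) - P.leftAct₁ η' (P.leftAct₁ η u) := by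
  induction u using G.induction_left generalizing η η' with
  | one => simp
  | mul ξ u hu =>
    simp only [leftAct₁_incl_mul, map_add, l_lie, r_compat, map_sub, LinearMap.add_apply,
      LinearMap.sub_apply, hu]
    noncomm_ring
  | add a b ha hb => simp only [map_add, ha, hb]; abel
  | smul c a ha => simp only [map_smul, ha, smul_sub]

/-- The untwisted action of the enveloping algebra of `h` on the enveloping algebra of `g`. -/
def leftAct : H.U →ₐ[K] Module.End K G.U :=
  H.lift (A := Module.End K G.U) P.leftAct₁ fun η η' => LinearMap.ext fun u => P.leftAct₁_lie η η' u

@[simp] lemma leftAct_incl (η : h) : P.leftAct (H.incl η) = P.leftAct₁ η := H.lift_incl _ _ η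

/-- Since `Δ(ξ u) = (ξ ⊗ 1 + 1 ⊗ ξ) Δ(u)`, a generator in the first leg comes out in front (`h₁`),
while one in the second leg replaces `η` by `η ◁ ξ` (`h₂`). These match the last two terms of the
recursion. -/
lemma leftAct₁_mul (η : h) (u v : G.U) : P.leftAct₁ η (u * v) = P.leftAct₁ η u * v +
    TensorProduct.lift ((LinearMap.mul K G.U).compl₂
      (P.leftAct₁.flip v ∘ₗ P.rightAct.flip η)) (G.uComul u) := by
  induction u using G.induction_left generalizing η with
  | one => simp [HomLie.uComul_one, Algebra.TensorProduct.one_def]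
  | mul ξ u hu =>
    rw [mul_assoc, leftAct₁_incl_mul, leftAct₁_incl_mul, hu, hu, HomLie.uComul_mul,
      HomLie.uComul_incl, add_mul (G.incl ξ ⊗ₜ[K] (1 : G.U)), map_add]
    have h₁ (z : G.U ⊗[K] G.U) : TensorProduct.lift ((LinearMap.mul K G.U).compl₂
        (P.leftAct₁.flip v ∘ₗ P.rightAct.flip η)) (G.incl ξ ⊗ₜ[K] (1 : G.U) * z) =
        G.incl ξ * TensorProduct.lift ((LinearMap.mul K G.U).compl₂
          (P.leftAct₁.flip v ∘ₗ P.rightAct.flip η)) z := by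
      induction z with
      | zero => simp
      | add a b ha hb => simp only [mul_add, map_add, ha, hb]
      | tmul a b => simp [mul_assoc]
    have h₂ (z : G.U ⊗[K] G.U) : TensorProduct.lift ((LinearMap.mul K G.U).compl₂
        (P.leftAct₁.flip v ∘ₗ P.rightAct.flip η)) ((1 : G.U) ⊗ₜ[K] G.incl ξ * z) =
        TensorProduct.lift ((LinearMap.mul K G.U).compl₂
          (P.leftAct₁.flip v ∘ₗ P.rightAct.flip (P.r η ξ))) z := by
      induction z with
      | zero => simp
      | add a b ha hb => simp only [mul_add, map_add, ha, hb]
      | tmul a b => simp [rightAct_mul]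
    rw [h₁, h₂]
    noncomm_ring
  | add a b ha hb => simp only [add_mul, map_add, ha, hb]; abel
  | smul c a ha => simp only [smul_mul_assoc, map_smul, ha, smul_add]

/-! ### Compatibility of the action with twisting maps, counit and coproduct. -/

lemma twist_leftAct₁ (η : h) (u : G.U) :
    G.uTwist (P.leftAct₁ η u) = P.leftAct₁ (H.twist η) (G.uTwist u) := by
  induction u using G.induction_left generalizing η with
  | one => rw [← G.uOne_eq, G.uTwist_uOne, G.uOne_eq, leftAct₁_one, leftAct₁_one, map_zero]
  | mul ξ u hu =>
    simp only [leftAct₁_incl_mul, map_add, HomLie.uTwist_mul, HomLie.uTwist_incl, twist_l,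
      twist_r, hu]
  | add a b ha hb => simp only [map_add, ha, hb]
  | smul c a ha => simp only [map_smul, ha]

lemma twist_leftAct (Ω : H.U) (u : G.U) :
    G.uTwist (P.leftAct Ω u) = P.leftAct (H.uTwist Ω) (G.uTwist u) := by
  induction Ω using H.induction_left generalizing u with
  | one => rw [← H.uOne_eq, H.uTwist_uOne, H.uOne_eq, map_one]; rfl
  | mul η Ω hΩ =>
    simp only [HomLie.uTwist_mul, HomLie.uTwist_incl, map_mul, Module.End.mul_apply,
      leftAct_incl, twist_leftAct₁, hΩ]
  | add a b ha hb => simp only [map_add, LinearMap.add_apply, ha, hb]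
  | smul c a ha => simp only [map_smul, LinearMap.smul_apply, ha]

lemma counit_leftAct₁ (η : h) (u : G.U) : G.uCounit (P.leftAct₁ η u) = 0 := by
  induction u using G.induction_left generalizing η with
  | one => simp
  | mul ξ u hu => simp [leftAct₁_incl_mul, HomLie.uCounit_mul, HomLie.uCounit_incl, hu]
  | add a b ha hb => simp only [map_add, ha, hb, add_zero]
  | smul c a ha => simp only [map_smul, ha, smul_zero]

lemma counit_leftAct (Ω : H.U) (u : G.U) :
    G.uCounit (P.leftAct Ω u) = H.uCounit Ω * G.uCounit u := by
  induction Ω using H.induction_left with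
  | one => simp [HomLie.uCounit_one]
  | mul η Ω _ => simp [counit_leftAct₁, HomLie.uCounit_mul, HomLie.uCounit_incl]
  | add a b ha hb => simp only [map_add, LinearMap.add_apply, ha, hb, add_mul]
  | smul c a ha => simp only [map_smul, LinearMap.smul_apply, ha, smul_eq_mul, mul_assoc]

/-- Elements of `h` act by coderivations: the recursion applied in either leg of `Δ(ξ u)` reproduces
the terms, because `η ▷ ξ` and `ξ` are both primitive. -/
lemma comul_leftAct₁ (η : h) (u : G.U) : G.uComul (P.leftAct₁ η u) =
    TensorProduct.map (P.leftAct₁ η) LinearMap.id (G.uComul u) +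
      TensorProduct.map LinearMap.id (P.leftAct₁ η) (G.uComul u) := by
  induction u using G.induction_left generalizing η with
  | one => simp [HomLie.uComul_one, Algebra.TensorProduct.one_def]
  | mul ξ u hu =>
    rw [leftAct₁_incl_mul, map_add, map_add, hu, HomLie.uComul_mul, HomLie.uComul_mul, hu,
      HomLie.uComul_mul, HomLie.uComul_incl, HomLie.uComul_incl]
    induction G.uComul u with
    | zero => simp
    | add a b ha hb =>
      simp only [mul_add, map_add] at ha hb ⊢
      convert congrArg₂ (· + ·) ha hb using 1 <;> abel
    | tmul a b =>
      simp [add_mul, mul_add, leftAct₁_incl_mul, TensorProduct.tmul_add, TensorProduct.add_tmul]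
      abel
  | add a b ha hb => simp only [map_add, ha, hb]; abel
  | smul c a ha => simp only [map_smul, ha, smul_add]

/-- The coderivation property is the case of the primitive element `η`; the general case follows
along products. -/
lemma comul_leftAct (Ω : H.U) (u : G.U) : G.uComul (P.leftAct Ω u) =
    TensorProduct.map₂ P.leftAct.toLinearMap P.leftAct.toLinearMap (H.uComul Ω) (G.uComul u) := by
  induction Ω using H.induction_left with
  | one =>
    rw [map_one P.leftAct, HomLie.uComul_one, Algebra.TensorProduct.one_def]
    induction G.uComul u with
    | zero => simp
    | add a b ha hb => simpa only [map_add] using congrArg₂ (· + ·) ha hb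
    | tmul a b => simp
  | mul η Ω hΩ =>
    rw [map_mul P.leftAct, Module.End.mul_apply, leftAct_incl, comul_leftAct₁, hΩ, HomLie.uComul_mul,
      HomLie.uComul_incl]
    induction H.uComul Ω with
    | zero => simp
    | add a b ha hb =>
      simp only [mul_add, map_add, LinearMap.add_apply] at ha hb ⊢
      rw [← ha, ← hb]; abel
    | tmul a b =>
      induction G.uComul u with
      | zero => simp
      | add c d hc hd =>
        simp only [map_add] at hc hd ⊢
        rw [← hc, ← hd]; abel
      | tmul c d => simp [add_mul]
  | add a b ha hb => simp only [map_add, LinearMap.add_apply, ha, hb]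
  | smul c a ha => simp only [map_smul, LinearMap.smul_apply, ha]

end HomLieMatchedPair

/-! ### The twisted actions -/

namespace HomLieMatchedPair

variable {K : Type*} [Field K] {g h : Type*} [AddCommGroup g] [Module K g]
  [AddCommGroup h] [Module K h] {G : HomLie K g} {H : HomLie K h}
  [hG : G.IsRegular] [hH : H.IsRegular] (P : HomLieMatchedPair G H)

/-- The right Hom-action of the enveloping algebra of `g` on `h`. -/
def inducedRight : h →ₗ[K] G.U →ₗ[K] h := P.rightAct.flip.compr₂ H.twist

/-- The left Hom-action of the enveloping algebra of `h` on the enveloping algebra of `g`. -/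
def inducedLeft : H.U →ₗ[K] G.U →ₗ[K] G.U := P.leftAct.toLinearMap.compr₂ G.uTwist

lemma inducedRight_apply (η : h) (u : G.U) :
    P.inducedRight η u = H.twist (P.rightAct u η) := rfl

lemma inducedLeft_apply (Ω : H.U) (u : G.U) :
    P.inducedLeft Ω u = G.uTwist (P.leftAct Ω u) := rfl

lemma inducedLeft_uLeaf (η : h) (u : G.U) :
    P.inducedLeft (H.uLeaf 0 η) u = G.uTwist (P.leftAct₁ η u) :=
  congrArg G.uTwist (LinearMap.congr_fun (P.leftAct_incl η) u)

/-- An associative action that is equivariant for the twisting maps becomes a Hom-action when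
followed by the twist of the module. The product rule is `leftAct₁_mul` up to powers of `φ`. -/
lemma isInduced : P.IsInduced P.inducedRight P.inducedLeft where
  right_module := by
    refine ⟨fun η a b => ?_, fun η => congrArg H.twist (P.rightAct_one η)⟩
    change P.inducedRight (P.inducedRight η a) (G.uTwist b) =
      P.inducedRight (H.twist η) (G.uMul a b)
    simp only [inducedRight_apply, HomLie.uMul_eq, rightAct_mul, twist_rightAct]
  right_leaf η s ξ := by
    rw [HomLie.uLeaf_eq_incl, inducedRight_apply, rightAct_incl, r_apply, HomLie.twist_symm]
  left_module := by
    refine ⟨fun a b u => ?_, fun u => ?_⟩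
    · change P.inducedLeft (H.uTwist a) (P.inducedLeft b u) =
        P.inducedLeft (H.uMul a b) (G.uTwist u)
      simp only [inducedLeft_apply, HomLie.uMul_eq, map_mul, Module.End.mul_apply, twist_leftAct]
    · exact congrArg G.uTwist (LinearMap.congr_fun (map_one P.leftAct) u)
  left_one η := by
    rw [inducedLeft_uLeaf]
    exact (congrArg G.uTwist (P.leftAct₁_one η)).trans (map_zero _)
  left_leaf η s ξ := by
    have h (s : ℕ) : (G.twist ^ s) (P.left η ξ) = P.left ((H.twist ^ s) η) ((G.twist ^ s) ξ) := by
      induction s with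
      | zero => simp
      | succ s ih => simp only [pow_succ', Module.End.mul_apply, ih, twist_left]
    rw [inducedLeft_uLeaf, HomLie.uLeaf_eq_incl, HomLie.uLeaf_eq_incl, leftAct₁_incl,
      HomLie.uTwist_incl, l_apply, HomLie.twist_symm, h]
  left_mul η w u := by
    change P.inducedLeft _ (G.uMul (G.uTwist w) u) =
      G.uMul (P.inducedLeft _ (G.uTwist w)) (G.uTwist u) + TensorProduct.lift
        (G.uMul.compl₁₂ (G.uTwist ∘ₗ G.uTwist)
          (P.inducedLeft.flip u ∘ₗ H.uLeaf 0 ∘ₗ P.inducedRight η)) (G.uComul w)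
    -- Equivariance pulls one twist out of the action, leaving `φ²` applied to the untwisted product
    -- rule for `α(η)` and `φ(w) * u`.
    rw [inducedLeft_uLeaf, inducedLeft_uLeaf, HomLie.uMul_eq', HomLie.uMul_eq',
      ← twist_leftAct₁, leftAct₁_mul, map_add, map_add, ← twist_leftAct₁, HomLie.uTwist_mul,
      HomLie.uTwist_mul]
    congr 1
    rw [HomLie.uComul_uTwist]
    induction G.uComul w with
    | zero => simp
    | add a b ha hb => simp only [map_add, ha, hb]
    | tmul a b =>
      simp [inducedLeft_uLeaf, inducedRight_apply, HomLie.uMul_eq, HomLie.uTwist_mul,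
        twist_rightAct]

/-! ### Uniqueness of the induced actions. -/

variable {P} {R R' : h →ₗ[K] G.U →ₗ[K] h} {L L' : H.U →ₗ[K] G.U →ₗ[K] G.U}

-- Equivariance is a consequence of the module laws: compare `𝟏 ▷ (Ω ▷ u)` with `(𝟏 ∨ Ω) ▷ φ(u)`.
omit hG hH in
lemma IsInduced.twist_left (hRL : P.IsInduced R L) (Ω : H.U) (u : G.U) :
    G.uTwist (L Ω u) = L (H.uTwist Ω) (G.uTwist u) := by
  have h := hRL.left_module.assoc H.uOne Ω u
  change L (H.uTwist H.uOne) (L Ω u) = L (H.uMul H.uOne Ω) (G.uTwist u) at h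
  rw [H.uTwist_uOne, H.uOne_mul] at h
  exact (hRL.left_module.one (L Ω u)).symm.trans h

lemma IsInduced.right_unique (hRL : P.IsInduced R L) (hRL' : P.IsInduced R' L') : R = R' := by
  refine LinearMap.ext fun η => LinearMap.ext fun u => ?_
  induction u using G.induction_left generalizing η with
  | one => exact (hRL.right_module.one η).trans (hRL'.right_module.one η).symm
  | mul ξ u hu =>
    -- Preimages bring `η ◁ (ξ * u)` to the form `α(η) ◁ (ξ ∨ u)` of the module law; the induction
    -- hypothesis then concerns `φ(u)`, as that law requires.
    obtain ⟨η, rfl⟩ := hH.bijective.2 η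
    obtain ⟨ξ, rfl⟩ := hG.bijective.2 ξ
    obtain ⟨u, rfl⟩ := (Function.LeftInverse.surjective G.uTwist_uTwistInv) u
    rw [← HomLie.uTwist_incl, ← HomLie.uMul_eq]
    have hleaf : R η (G.incl ξ) = R' η (G.incl ξ) :=
      (hRL.right_leaf η 0 ξ).trans (hRL'.right_leaf η 0 ξ).symm
    have h := hRL.right_module.assoc η (G.incl ξ) u
    have h' := hRL'.right_module.assoc η (G.incl ξ) u
    rw [hleaf] at h
    exact h.symm.trans ((hu _).trans h')
  | add a b ha hb => simp only [map_add, ha, hb]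
  | smul c a ha => simp only [map_smul, ha]

lemma IsInduced.left_incl_unique (hRL : P.IsInduced R L) (hRL' : P.IsInduced R' L')
    (η : h) (u : G.U) : L (H.incl η) u = L' (H.incl η) u := by
  obtain rfl := hRL.right_unique hRL'
  induction u using G.induction_left generalizing η with
  | one => exact (hRL.left_one η).trans (hRL'.left_one η).symm
  | mul ξ u hu =>
    -- The product rule is stated for `α²(η)` and `φ(w) ∨ u'`. So `η` needs two preimages, and so
    -- does `ξ`: one to pass from `*` to `∨`, one for `w = ξ`.
    obtain ⟨η, rfl⟩ := hH.bijective.2 η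
    obtain ⟨η, rfl⟩ := hH.bijective.2 η
    obtain ⟨ξ, rfl⟩ := hG.bijective.2 ξ
    obtain ⟨ξ, rfl⟩ := hG.bijective.2 ξ
    obtain ⟨u, rfl⟩ := (Function.LeftInverse.surjective G.uTwist_uTwistInv) u
    have h₁ : L (H.uLeaf 0 (H.twist η)) (G.uTwist (G.incl ξ)) =
        L' (H.uLeaf 0 (H.twist η)) (G.uTwist (G.incl ξ)) := by
      rw [HomLie.uTwist_incl]
      exact (hRL.left_leaf _ 0 _).trans (hRL'.left_leaf _ 0 _).symm
    -- The hypothesis is available at `φ(u)` but the product rule acts on `u`; equivariance and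
    -- injectivity of `φ` bridge the gap.
    have h₂ : L.flip u ∘ₗ H.uLeaf 0 = L'.flip u ∘ₗ H.uLeaf 0 := by
      refine LinearMap.ext fun η' => (Function.LeftInverse.injective G.uTwistInv_uTwist) ?_
      have h := hu (H.twist η')
      rw [← HomLie.uTwist_incl, ← hRL.twist_left, ← hRL'.twist_left] at h
      exact h
    rw [← G.uTwist_incl, ← G.uMul_eq, ← G.uTwist_incl]
    refine (hRL.left_mul η (G.incl ξ) u).trans (Eq.trans ?_ (hRL'.left_mul η (G.incl ξ) u).symm)
    rw [← LinearMap.comp_assoc, ← LinearMap.comp_assoc, h₂]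
    exact congrArg (fun x => G.uMul x (G.uTwist u) + _) h₁
  | add a b ha hb => simp only [map_add, ha, hb]
  | smul c a ha => simp only [map_smul, ha]

lemma IsInduced.left_unique (hRL : P.IsInduced R L) (hRL' : P.IsInduced R' L') : L = L' := by
  refine LinearMap.ext fun Ω => LinearMap.ext fun u => ?_
  induction Ω using H.induction_left generalizing u with
  | one => exact (hRL.left_module.one u).trans (hRL'.left_module.one u).symm
  | mul η Ω hΩ =>
    obtain ⟨η, rfl⟩ := hH.bijective.2 η
    obtain ⟨Ω, rfl⟩ := (Function.LeftInverse.surjective H.uTwist_uTwistInv) Ω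
    obtain ⟨u, rfl⟩ := (Function.LeftInverse.surjective G.uTwist_uTwistInv) u
    -- Here too the hypothesis holds at `φ(Ω)` and all vectors, and is carried back through the
    -- injective `φ`.
    have hu : L Ω u = L' Ω u := by
      refine (Function.LeftInverse.injective G.uTwistInv_uTwist) ?_
      rw [hRL.twist_left, hRL'.twist_left, hΩ]
    have h₁ : L (H.uTwist (H.incl η)) (L Ω u) = L' (H.uTwist (H.incl η)) (L' Ω u) := by
      rw [hu, HomLie.uTwist_incl, hRL.left_incl_unique hRL']
    rw [← HomLie.uTwist_incl, ← HomLie.uMul_eq]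
    exact (hRL.left_module.assoc (H.incl η) Ω u).symm.trans
      (h₁.trans (hRL'.left_module.assoc (H.incl η) Ω u))
  | add a b ha hb => simp only [map_add, LinearMap.add_apply, ha, hb]
  | smul c a ha => simp only [map_smul, LinearMap.smul_apply, ha]

/-! ### The module coalgebra. -/

variable (P)

lemma inducedLeft_isLeftHomModuleCoalgebra :
    IsLeftHomModuleCoalgebra H.env G.env.comul G.env.counit G.env.cotwist G.env.twist
      P.inducedLeft where
  bialgebra := H.env_isHomHopf.bialgebra
  coalgebra := G.env_isHomHopf.bialgebra.coalgebra
  endo := ⟨G.uComul_uTwist, G.uCounit_uTwist, fun _ => rfl⟩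
  module := P.isInduced.left_module
  cotwist _ _ := rfl
  comul Ω u := by
    change G.uComul (G.uTwist (P.leftAct Ω u)) =
      TensorProduct.map₂ P.inducedLeft P.inducedLeft (H.uComul Ω) (G.uComul u)
    rw [HomLie.uComul_uTwist, comul_leftAct]
    induction H.uComul Ω with
    | zero => simp
    | add a b ha hb => simp only [map_add, LinearMap.add_apply, ha, hb]
    | tmul a b =>
      induction G.uComul u with
      | zero => simp
      | add c d hc hd => simp only [map_add, hc, hd]
      | tmul c d => simp [inducedLeft_apply]
  counit Ω u := (G.uCounit_uTwist _).trans (P.counit_leftAct Ω u)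

end HomLieMatchedPair

end

theorem mainTheorem9 {K : Type*} [Field K] {g h : Type*} [AddCommGroup g] [Module K g]
    [AddCommGroup h] [Module K h] (G : HomLie K g) (H : HomLie K h)
    (hG : Function.Bijective G.twist) (hH : Function.Bijective H.twist)
    (P : HomLieMatchedPair G H) :
    G.env.IsHomHopf ∧ H.env.IsHomHopf ∧
      ∃ (R : h →ₗ[K] G.U →ₗ[K] h) (L : H.U →ₗ[K] G.U →ₗ[K] G.U),
        P.IsInduced R L ∧
        (∀ R' L', P.IsInduced R' L' → R' = R ∧ L' = L) ∧
        IsLeftHomModuleCoalgebra H.env G.env.comul G.env.counit G.env.cotwist G.env.twist L := by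
  have : G.IsRegular := ⟨hG⟩
  have : H.IsRegular := ⟨hH⟩
  exact ⟨G.env_isHomHopf, H.env_isHomHopf, P.inducedRight, P.inducedLeft, P.isInduced,
    fun _ _ hRL => ⟨hRL.right_unique P.isInduced, hRL.left_unique P.isInduced⟩, P.inducedLeft_isLeftHomModuleCoalgebra⟩
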